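/- Let $V=\{1,\dots,n\}$ and let $G=(V,E^+)$ be a complete graph with edges labelled $+$ or $-$, identified with its graph $E^+$ of $+$ edges. A clustering is a function $\ell:V\to\mathbb N$; its cost is the number of unordered pairs $\{x,y\}$ that are $-$ edges with $\ell(x)=\ell(y)$ or $+$ edges with $\ell(x)\ne\ell(y)$; $\mathrm{OPT}$ is the minimum cost of a clustering of $G$. Write $\Gamma^+(v)$ for the set of vertices joined to $v$ by a $+$ edge. Algorithm Non-adaptive QECC, with query budget a positive integer $Q$: put $k=\max\{t\le n : (2n-1-t)\,t\le 2Q\}$ and draw a uniformly random sequence $s_1,\dots,s_k$ of vertices, with or without replacement. Query, once each, all pairs $\{v,w\}$ with $v\in\{s_1,\dots,s_k\}$ and $w\in V\setminus\{v\}$. Then, starting from $R=V$, for $i=1,\dots,k$: if $s_i\in R$, output the cluster $C=\{s_i\}\cup(\Gamma^+(s_i)\cap R)$ and remove $C$ from $R$. The vertices remaining in $R$ are singleton clusters. Theorem. For every integer $Q>0$, Non-adaptive QECC makes at most $Q$ queries, all of them fixed before any answer is seen (their distribution does not depend on $G$), and it finds a clustering of $G$ with expected cost at most $$3\cdot\mathrm{OPT}+\frac{n^3}{2Q};$$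 when the sample is drawn with replacement, the bound on the expected cost is claimed for $Q\le n^2$ (which includes every $Q\le\binom n2$). It runs in time $O(Q)$, with a constant that does not depend on $n$, $Q$ or $G$, assuming that a query, the drawing of a uniformly random element of $\{0,\dots,m-1\}$, an arithmetic operation and an access to a dictionary take unit time, and that the vertices left in $R$ at the end are represented implicitly (as the vertices without a cluster label). -/

import Mathlib

open scoped ENNReal

/-! ### Correlation clustering

A complete graph on `Fin n` with `+`/`-` edge labels is identified with the graph of its `+` edges. -/

open Classical in
/-- The 0/1 similarity function of a labelled complete graph. -/
noncomputable def similarity {n : ℕ} (G : SimpleGraph (Fin n)) (x y : Fin n) : ℕ :=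
  if G.Adj x y then 1 else 0

/-- The number of disagreements of the clustering `cl` (a labelling of the vertices by cluster
identifiers), summed over the unordered pairs of distinct vertices. -/
noncomputable def clusteringCost {n : ℕ} (G : SimpleGraph (Fin n)) (cl : Fin n → ℕ) : ℕ :=
  (∑ p : Fin n × Fin n with p.1 < p.2 ∧ cl p.1 = cl p.2, (1 - similarity G p.1 p.2)) +
    ∑ p : Fin n × Fin n with p.1 < p.2 ∧ cl p.1 ≠ cl p.2, similarity G p.1 p.2

/-- The cost of an optimal clustering. -/
noncomputable def optCost {n : ℕ} (G : SimpleGraph (Fin n)) : ℕ :=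
  sInf (Set.range (clusteringCost G))

/-! ### A randomized unit-cost machine with batched queries

Programs over natural-number registers (named by `ι`) and dictionaries keyed by pairs of numbers
(named by `τ`, initially everywhere `0`). Each elementary operation takes one step. A program can
request a similarity query, but it does not see the graph: the answers become available in the
read-only dictionary `answers` only when all requests made so far are answered in one batch. -/

/-- Expressions. Comparisons and connectives have value `0` or `1`; subtraction is truncated. -/
inductive Expr (ι τ : Type) : Type
  | const (c : ℕ)
  | var (x : ι)
  | get (t : τ) (a b : Expr ι τ)
  | answer (a b : Expr ι τ)
  | add (a b : Expr ι τ)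
  | sub (a b : Expr ι τ)
  | mul (a b : Expr ι τ)
  | le (a b : Expr ι τ)
  | eq (a b : Expr ι τ)
  | and (a b : Expr ι τ)
  | or (a b : Expr ι τ)

/-- Commands. -/
inductive Cmd (ι τ : Type) : Type
  /-- `x := a` -/
  | set (x : ι) (a : Expr ι τ)
  /-- `t[a, b] := c` -/
  | put (t : τ) (a b c : Expr ι τ)
  /-- `x :=` a uniformly random element of `{0, …, a - 1}` (and `x := 0` if `a = 0`) -/
  | rand (x : ι) (a : Expr ι τ)
  /-- request the query of the pair `(a, b)` -/
  | ask (a b : Expr ι τ)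
  | seq (c d : Cmd ι τ)
  /-- `if a ≠ 0 then c` -/
  | when (a : Expr ι τ) (c : Cmd ι τ)
  /-- `for x = 0, …, a - 1 do c`, where `a` is evaluated once, on entry -/
  | loop (x : ι) (a : Expr ι τ) (c : Cmd ι τ)

/-- Configurations: registers, dictionaries, answers received, the list of all requests made, and
the number of steps taken so far. -/
structure Config (ι τ : Type) : Type where
  reg : ι → ℕ
  tab : τ → ℕ → ℕ → ℕ
  answers : ℕ → ℕ → ℕ
  requests : List (ℕ × ℕ)
  time : ℕ

namespace Expr

variable {ι τ : Type}

/-- The value of an expression. -/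
def eval (s : Config ι τ) : Expr ι τ → ℕ
  | const c => c
  | var x => s.reg x
  | get t a b => s.tab t (a.eval s) (b.eval s)
  | answer a b => s.answers (a.eval s) (b.eval s)
  | add a b => a.eval s + b.eval s
  | sub a b => a.eval s - b.eval s
  | mul a b => a.eval s * b.eval s
  | le a b => if a.eval s ≤ b.eval s then 1 else 0
  | eq a b => if a.eval s = b.eval s then 1 else 0
  | and a b => if a.eval s ≠ 0 ∧ b.eval s ≠ 0 then 1 else 0
  | or a b => if a.eval s ≠ 0 ∨ b.eval s ≠ 0 then 1 else 0

/-- The number of steps to evaluate an expression: one for each node. -/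
def steps : Expr ι τ → ℕ
  | const _ => 1
  | var _ => 1
  | get _ a b => a.steps + b.steps + 1
  | answer a b => a.steps + b.steps + 1
  | add a b => a.steps + b.steps + 1
  | sub a b => a.steps + b.steps + 1
  | mul a b => a.steps + b.steps + 1
  | le a b => a.steps + b.steps + 1
  | eq a b => a.steps + b.steps + 1
  | and a b => a.steps + b.steps + 1
  | or a b => a.steps + b.steps + 1

end Expr

namespace Config

variable {ι τ : Type}

/-- Let `m` steps pass. -/
def tick (s : Config ι τ) (m : ℕ) : Config ι τ := { s with time := s.time + m }

/-- Store `m` in the register `x`. -/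
def setReg [DecidableEq ι] (s : Config ι τ) (x : ι) (m : ℕ) : Config ι τ :=
  { s with reg := Function.update s.reg x m }

/-- Store `m` in the dictionary `t` under the key `(a, b)`. -/
def setTab [DecidableEq τ] (s : Config ι τ) (t : τ) (a b m : ℕ) : Config ι τ :=
  { s with
    tab := Function.update s.tab t (Function.update (s.tab t) a (Function.update (s.tab t a) b m)) }

/-- Add the pair `(a, b)` to the list of requests. -/
def addRequest (s : Config ι τ) (a b : ℕ) : Config ι τ :=
  { s with requests := (a, b) :: s.requests }

open Classical in
/-- Answer all requests made so far, in one batch, at one step per query. -/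
noncomputable def answerRequests {n : ℕ} (G : SimpleGraph (Fin n)) (s : Config ι τ) :
    Config ι τ :=
  { s with
    answers := fun a b =>
      if (a, b) ∈ s.requests ∧ ∃ (ha : a < n) (hb : b < n), G.Adj ⟨a, ha⟩ ⟨b, hb⟩ then 1 else 0
    time := s.time + s.requests.length }

end Config

/-- The uniform distribution on `{0, …, m - 1}` (the point mass at `0` if `m = 0`). -/
noncomputable def uniformBelow (m : ℕ) : PMF ℕ :=
  if h : 0 < m then PMF.uniformOfFinset (Finset.range m) ⟨0, Finset.mem_range.2 h⟩
  else PMF.pure 0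

/-- `iterateFor f m s`: run `f 0`, `f 1`, …, `f (m - 1)` in this order, starting from `s`. -/
noncomputable def iterateFor {σ : Type} (f : ℕ → σ → PMF σ) : ℕ → σ → PMF σ
  | 0, s => PMF.pure s
  | m + 1, s => (iterateFor f m s).bind (f m)

/-- The distribution of the configuration reached by a command. -/
noncomputable def Cmd.run {ι τ : Type} [DecidableEq ι] [DecidableEq τ] :
    Cmd ι τ → Config ι τ → PMF (Config ι τ)
  | .set x a => fun s => PMF.pure ((s.setReg x (a.eval s)).tick (a.steps + 1))
  | .put t a b c => fun s =>
      PMF.pure ((s.setTab t (a.eval s) (b.eval s) (c.eval s)).tick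
        (a.steps + b.steps + c.steps + 1))
  | .rand x a => fun s =>
      (uniformBelow (a.eval s)).map fun m => (s.setReg x m).tick (a.steps + 1)
  | .ask a b => fun s =>
      PMF.pure ((s.addRequest (a.eval s) (b.eval s)).tick (a.steps + b.steps + 1))
  | .seq c d => fun s => (c.run s).bind d.run
  | .when a c => fun s =>
      if a.eval s ≠ 0 then c.run (s.tick (a.steps + 1)) else PMF.pure (s.tick (a.steps + 1))
  | .loop x a c => fun s =>
      iterateFor (fun i s' => c.run ((s'.setReg x i).tick 1)) (a.eval s) (s.tick (a.steps + 1))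

/-- The expectation of a nonnegative function of a random outcome. -/
noncomputable def expectedValue {σ : Type} (p : PMF σ) (f : σ → ℝ≥0∞) : ℝ≥0∞ :=
  ∑' s, p s * f s

/-! ### The algorithm Non-adaptive QECC -/

namespace NAQECC

/-- The two ways of drawing the sample of pivots. -/
inductive Sampling : Type
  | withReplacement
  | withoutReplacement

/-- Registers. The inputs are `n` (number of vertices) and `Q` (query budget). -/
inductive Reg : Type
  | n | Q | k | t | i | v | w | r | u
  deriving DecidableEq

/-- Dictionaries; a key that is a single number `a` is written as `(a, 0)`. -/
inductive Tab : Type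
  /-- `sample[i]` is the `i`-th vertex of the sample -/
  | sample
  /-- `swap[j]` is `0` if position `j` of the shuffled list `0, …, n - 1` still holds `j`, and
  otherwise it is the element held there plus one -/
  | swap
  /-- `mark[v] = 1` if the requests of the pairs with `v` have been made -/
  | mark
  /-- `label[v]` is the identifier of the cluster of `v`, and `0` as long as `v` is unclustered -/
  | label
  deriving DecidableEq

open Expr Cmd

/-- `k := max {t ≤ n ∣ (2 n - 1 - t) t ≤ 2 Q}`; it suffices to try `t ≤ Q + 1`, as the maximum never
exceeds `Q + 1`. -/
def computeK : Cmd Reg Tab :=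
  .loop .t (add (var .Q) (const 2)) <|
    .when (le (var .t) (var .n)) <|
      .when (le (mul (sub (sub (mul (const 2) (var .n)) (const 1)) (var .t)) (var .t))
        (mul (const 2) (var .Q))) <|
        .set .k (var .t)

/-- Draw a uniformly random sample of `k` vertices. Without replacement, these are the first `k`
entries of a Fisher–Yates shuffle of `0, …, n - 1`. -/
def drawSample : Sampling → Cmd Reg Tab
  | .withReplacement =>
    .loop .i (var .k) <|
      .seq (.rand .r (var .n)) <|
      .put .sample (var .i) (const 0) (var .r)
  | .withoutReplacement =>
    .loop .i (var .k) <|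
      .seq (.rand .r (sub (var .n) (var .i))) <|
      .seq (.set .r (add (var .i) (var .r))) <|
      .seq (.set .v (get .swap (var .r) (const 0))) <|
      .seq (.when (eq (var .v) (const 0)) (.set .v (add (var .r) (const 1)))) <|
      .seq (.set .u (get .swap (var .i) (const 0))) <|
      .seq (.when (eq (var .u) (const 0)) (.set .u (add (var .i) (const 1)))) <|
      .seq (.put .swap (var .r) (const 0) (var .u)) <|
      .put .sample (var .i) (const 0) (sub (var .v) (const 1))

/-- Request all pairs with a vertex in the sample, each of them once. -/
def requestNeighbourhoods : Cmd Reg Tab :=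
  .loop .i (var .k) <|
    .seq (.set .v (get .sample (var .i) (const 0))) <|
    .when (eq (get .mark (var .v) (const 0)) (const 0)) <|
      .seq (.put .mark (var .v) (const 0) (const 1)) <|
      .loop .w (var .n) <|
        .when (eq (get .mark (var .w) (const 0)) (const 0)) <|
          .ask (var .v) (var .w)

/-- The querying phase. -/
def queryPhase (sampling : Sampling) : Cmd Reg Tab :=
  .seq computeK (.seq (drawSample sampling) requestNeighbourhoods)

/-- The clustering phase: the sampled vertices are considered in order; each one that is still
unclustered becomes a pivot and forms a cluster with its unclustered `+` neighbours. -/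
def clusterPhase : Cmd Reg Tab :=
  .loop .i (var .k) <|
    .seq (.set .v (get .sample (var .i) (const 0))) <|
    .when (eq (get .label (var .v) (const 0)) (const 0)) <|
      .loop .w (var .n) <|
        .when (and (eq (get .label (var .w) (const 0)) (const 0))
          (or (eq (var .w) (var .v)) (answer (var .v) (var .w)))) <|
          .put .label (var .w) (const 0) (add (var .i) (const 1))

/-- The initial configuration: the inputs are `n` and `Q`, everything else is `0`. -/
def init (n Q : ℕ) : Config Reg Tab where
  reg := fun x => match x with
    | .n => n
    | .Q => Q
    | _ => 0
  tab := fun _ _ _ => 0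
  answers := fun _ _ => 0
  requests := []
  time := 0

/-- Non-adaptive QECC on the graph `G` with query budget `Q`: the querying phase runs without any
access to `G`, then all its requests are answered at once, and then the clustering phase runs. -/
noncomputable def run (sampling : Sampling) {n : ℕ} (G : SimpleGraph (Fin n)) (Q : ℕ) :
    PMF (Config Reg Tab) :=
  ((queryPhase sampling).run (init n Q)).bind fun s => clusterPhase.run (s.answerRequests G)

/-- The clustering described by a final configuration: vertices with equal nonzero labels share a
cluster, and each vertex without a label is a singleton cluster. -/
def output (n : ℕ) (s : Config Reg Tab) (v : Fin n) : ℕ :=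
  if s.tab .label v 0 = 0 then 2 * v else 2 * s.tab .label v 0 + 1

end NAQECC

/-!
Given the past, the next sampled vertex is uniform on a set that contains all unclustered vertices,
whether the sample is drawn with or without replacement. The cost is therefore controlled by two
potentials that do not increase in expectation. All pairs are counted as ordered pairs.

The first potential is the number of disagreements caused so far plus three times the number of
disagreements of an optimal clustering among the unclustered vertices. The pivot `v` causes a new
disagreement on `{x, y}` exactly when `v`, `x`, `y` form a triangle with two `+` edges and one `-`
edge. Every clustering disagrees with such a triangle somewhere, and averaging over which of the
three vertices is the pivot gives the factor `3`.

The second potential is `n |R| + i e`, where `R` is the set of unclustered vertices after `i`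
pivots and `e` is the number of `+` pairs in `R`. A uniform vertex of `R` removes `1 + e / |R|`
vertices on average, which pays for the increase of `i`. The potential starts at `n ^ 2`, and
`e ≤ n |R|`, so on average at most `n ^ 2 / (k + 1)` of the `+` pairs are left after `k` pivots;
finally `(k + 1) n ≥ Q` by the maximality of `k`, unless `k = n`.
-/

section Combinatorics

open Finset

variable {V α : Type*}

/-- The ordered pairs of elements of `R` that are related by `r`. -/
noncomputable def pairsIn (r : V → V → Prop) (R : Finset V) : Finset (V × V) :=
  open Classical in Rel.interedges r R R

/-- The ordered triples of elements of `R` that are related by `r`. -/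
noncomputable def triplesIn (r : V → V → V → Prop) (R : Finset V) : Finset (V × V × V) :=
  open Classical in {q ∈ R ×ˢ R ×ˢ R | r q.1 q.2.1 q.2.2}

theorem mem_pairsIn {r : V → V → Prop} {R : Finset V} {q : V × V} :
    q ∈ pairsIn r R ↔ q.1 ∈ R ∧ q.2 ∈ R ∧ r q.1 q.2 := by
  classical exact Rel.mem_interedges_iff

theorem mem_triplesIn {r : V → V → V → Prop} {R : Finset V} {q : V × V × V} :
    q ∈ triplesIn r R ↔ (q.1 ∈ R ∧ q.2.1 ∈ R ∧ q.2.2 ∈ R) ∧ r q.1 q.2.1 q.2.2 := by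
  simp only [triplesIn, mem_filter, mem_product]

theorem pairsIn_mono (r : V → V → Prop) {R S : Finset V} (h : R ⊆ S) :
    pairsIn r R ⊆ pairsIn r S := by
  classical exact Rel.interedges_mono h h

theorem card_pairsIn_le (r : V → V → Prop) (R : Finset V) : #(pairsIn r R) ≤ #R * #R := by
  classical exact Rel.card_interedges_le_mul r R R

theorem sum_card_pairsIn (r : V → V → V → Prop) (R : Finset V) :
    ∑ v ∈ R, #(pairsIn (r v) R) = #(triplesIn r R) := by
  classical
  rw [triplesIn, card_filter, sum_product]
  exact sum_congr rfl fun v _ => card_filter _ _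

theorem card_triplesIn_swap_left (r : V → V → V → Prop) (R : Finset V) :
    #(triplesIn (fun x y z => r y x z) R) = #(triplesIn r R) := by
  refine card_nbij' (fun q => (q.2.1, q.1, q.2.2)) (fun q => (q.2.1, q.1, q.2.2)) ?_ ?_ ?_ ?_ <;>
    simp +contextual [Set.MapsTo, Set.LeftInvOn, mem_triplesIn]

theorem card_triplesIn_swap_right (r : V → V → V → Prop) (R : Finset V) :
    #(triplesIn (fun x y z => r x z y) R) = #(triplesIn r R) := by
  refine card_nbij' (fun q => (q.1, q.2.2, q.2.1)) (fun q => (q.1, q.2.2, q.2.1)) ?_ ?_ ?_ ?_ <;>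
    simp +contextual [Set.MapsTo, Set.LeftInvOn, mem_triplesIn]

theorem two_mul_card_lt_and_adj [Fintype V] [LinearOrder V] (H : SimpleGraph V)
    [DecidableRel H.Adj] :
    2 * #{p : V × V | p.1 < p.2 ∧ H.Adj p.1 p.2} = #(pairsIn H.Adj univ) := by
  have card_gt : #{p : V × V | p.2 < p.1 ∧ H.Adj p.1 p.2} =
      #{p : V × V | p.1 < p.2 ∧ H.Adj p.1 p.2} := by
    refine card_nbij' Prod.swap Prod.swap ?_ ?_ ?_ ?_ <;>
      simp +contextual [Set.MapsTo, Set.LeftInvOn, H.adj_comm]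
  rw [two_mul]
  nth_rw 2 [← card_gt]
  rw [← card_union_of_disjoint]
  · refine congrArg card (ext fun p => ?_)
    simp only [mem_union, mem_filter_univ, mem_pairsIn, mem_univ, true_and, ← or_and_right]
    exact and_iff_right_of_imp fun h => h.ne.lt_or_gt
  · exact disjoint_filter.2 fun p _ hlt hgt => lt_asymm hlt.1 hgt.1

/-- The pairs on which the clustering `l` disagrees with the edge labels given by `G`. -/
def disagreementGraph (G : SimpleGraph V) (l : V → α) : SimpleGraph V where
  Adj x y := x ≠ y ∧ ¬(l x = l y ↔ G.Adj x y)
  symm := ⟨fun x y h => ⟨h.1.symm, by rw [eq_comm, G.adj_comm]; exact h.2⟩⟩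
  loopless := ⟨fun _ h => h.1 rfl⟩

theorem two_mul_clusteringCost {n : ℕ} (G : SimpleGraph (Fin n)) (l : Fin n → ℕ) :
    2 * clusteringCost G l = #(pairsIn (disagreementGraph G l).Adj univ) := by
  classical
  rw [← two_mul_card_lt_and_adj, card_filter, clusteringCost, sum_filter, sum_filter,
    ← sum_add_distrib]
  congr 1
  refine sum_congr rfl fun p _ => ?_
  by_cases hlt : p.1 < p.2
  · by_cases hl : l p.1 = l p.2 <;> by_cases hG : G.Adj p.1 p.2 <;>
      simp [similarity, disagreementGraph, hlt, hlt.ne, hl, hG]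
  · simp [hlt]

/-- `x` and `y` are distinct `+` neighbours of `c` joined to each other by a `-` edge. -/
def IsCherry (G : SimpleGraph V) (c x y : V) : Prop :=
  G.Adj c x ∧ G.Adj c y ∧ x ≠ y ∧ ¬G.Adj x y

/-- A triangle with two `+` edges and one `-` edge, the obstruction to a clustering of cost `0`. -/
def BadTriangle (G : SimpleGraph V) (x y z : V) : Prop :=
  IsCherry G x y z ∨ IsCherry G y x z ∨ IsCherry G z x y

theorem isCherry_comm {G : SimpleGraph V} {c x y : V} : IsCherry G c x y ↔ IsCherry G c y x := by
  unfold IsCherry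
  rw [ne_comm, G.adj_comm x y]
  tauto

theorem badTriangle_swap_left {G : SimpleGraph V} {x y z : V} :
    BadTriangle G y x z ↔ BadTriangle G x y z := by
  unfold BadTriangle
  rw [isCherry_comm (c := z)]
  tauto

theorem badTriangle_swap_right {G : SimpleGraph V} {x y z : V} :
    BadTriangle G x z y ↔ BadTriangle G x y z := by
  unfold BadTriangle
  rw [isCherry_comm (c := x)]
  tauto

theorem IsCherry.disagreement {G : SimpleGraph V} {c x y : V} (h : IsCherry G c x y) (l : V → α) :
    (disagreementGraph G l).Adj c x ∨ (disagreementGraph G l).Adj c y ∨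
      (disagreementGraph G l).Adj x y := by
  obtain ⟨hx, hy, hne, hxy⟩ := h
  have := hx.ne
  have := hy.ne
  simp only [disagreementGraph]
  grind

theorem BadTriangle.disagreement {G : SimpleGraph V} {x y z : V} (h : BadTriangle G x y z)
    (l : V → α) :
    (disagreementGraph G l).Adj x y ∨ (disagreementGraph G l).Adj x z ∨
      (disagreementGraph G l).Adj y z := by
  have comm := (disagreementGraph G l).adj_comm
  rcases h with h | h | h <;> have := h.disagreement l <;> grind

theorem sum_card_badTriangle_le (G : SimpleGraph V) (o : V → α) (R : Finset V) :
    ∑ v ∈ R, #(pairsIn (BadTriangle G v) R) ≤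
      3 * ∑ v ∈ R, #(pairsIn (BadTriangle G v ⊓ (disagreementGraph G o).Adj) R) := by
  classical
  set D := (disagreementGraph G o).Adj
  set T₁ := triplesIn (fun x y z => BadTriangle G x y z ∧ D y z) R with hT₁
  set T₂ := triplesIn (fun x y z => BadTriangle G x y z ∧ D x z) R with hT₂
  set T₃ := triplesIn (fun x y z => BadTriangle G x y z ∧ D x y) R
  have card_T₂ : #T₂ = #T₁ := by
    rw [hT₁, ← card_triplesIn_swap_left]
    simp only [badTriangle_swap_left]
  have card_T₃ : #T₃ = #T₂ := by
    rw [hT₂, ← card_triplesIn_swap_right]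
    simp only [badTriangle_swap_right]
  have cover : triplesIn (BadTriangle G) R ⊆ T₁ ∪ T₂ ∪ T₃ := fun q hq => by
    simp only [T₁, T₂, T₃, mem_union, mem_triplesIn] at hq ⊢
    have := hq.2.disagreement o
    tauto
  have := (card_le_card cover).trans (card_union_le _ _)
  have := card_union_le T₁ T₂
  have card_T₁ : ∑ v ∈ R, #(pairsIn (BadTriangle G v ⊓ D) R) = #T₁ := sum_card_pairsIn _ R
  rw [sum_card_pairsIn, card_T₁]
  omega

end Combinatorics

section Pivots

open Finset

variable {V α : Type*}

/-- The partial clustering `l` after the vertex `v` has been considered as a pivot: if `v` has no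
cluster yet, it and its `+` neighbours without a cluster form the cluster with label `c`. -/
noncomputable def pivotStep (G : SimpleGraph V) (c : ℕ) (l : V → ℕ) (v w : V) : ℕ :=
  open Classical in if l v = 0 ∧ l w = 0 ∧ (w = v ∨ G.Adj v w) then c else l w

theorem pivotStep_eq_self (G : SimpleGraph V) (c : ℕ) {l : V → ℕ} {v : V} (hv : l v ≠ 0) :
    pivotStep G c l v = l :=
  funext fun _ => if_neg fun h => hv h.1

theorem pivotStep_le {G : SimpleGraph V} {c : ℕ} {l : V → ℕ} {v w : V} (h : l w ≤ c) :
    pivotStep G c l v w ≤ c := by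
  unfold pivotStep
  split_ifs
  exacts [le_rfl, h]

theorem pivotStep_ne_zero_of_ne_zero {G : SimpleGraph V} {c : ℕ} {l : V → ℕ} {v w : V}
    (h : l w ≠ 0) : pivotStep G c l v w ≠ 0 := by
  simp [pivotStep, h]

theorem pivotStep_self_ne_zero {G : SimpleGraph V} {c : ℕ} {l : V → ℕ} {v : V} (hc : c ≠ 0) :
    pivotStep G c l v v ≠ 0 := by
  unfold pivotStep
  split_ifs with h
  · exact hc
  · exact fun h0 => h ⟨h0, h0, .inl rfl⟩

theorem adj_left_or_adj_right_of_badTriangle {G : SimpleGraph V} {v x y : V}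
    (h : BadTriangle G v x y) : G.Adj v x ∨ G.Adj v y := by
  rcases h with h | h | h
  exacts [.inl h.1, .inl h.1.symm, .inr h.1.symm]

variable [Fintype V]

/-- The vertices that have no cluster yet; as in the algorithm, their label is `0`. -/
def unlabelled (l : V → ℕ) : Finset V := {w | l w = 0}

theorem mem_unlabelled {l : V → ℕ} {w : V} : w ∈ unlabelled l ↔ l w = 0 :=
  mem_filter_univ w

/-- The disagreements with `G` that are already caused by the partial clustering `l`: those between
two vertices of which at least one has a cluster. -/
noncomputable def closedPairs (G : SimpleGraph V) (l : V → ℕ) : Finset (V × V) :=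
  pairsIn (fun x y => (disagreementGraph G l).Adj x y ∧ ¬(l x = 0 ∧ l y = 0)) univ

theorem card_pairsIn_disagreement_eq (G : SimpleGraph V) {l m : V → ℕ}
    (hm : ∀ x y, x ≠ y → (m x = m y ↔ l x = l y ∧ l x ≠ 0)) :
    #(pairsIn (disagreementGraph G m).Adj univ) =
      #(closedPairs G l) + #(pairsIn G.Adj (unlabelled l)) := by
  classical
  rw [← card_union_of_disjoint]
  · refine congrArg card (ext fun p => ?_)
    simp only [closedPairs, mem_union, mem_pairsIn, mem_unlabelled, disagreementGraph, mem_univ]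
    have := hm p.1 p.2
    have := G.ne_of_adj (a := p.1) (b := p.2)
    grind
  · refine disjoint_left.2 fun p hp hp' => (mem_pairsIn.1 hp).2.2.2 ?_
    simp only [mem_pairsIn, mem_unlabelled] at hp'
    exact ⟨hp'.1, hp'.2.1⟩

theorem unlabelled_pivotStep_subset (G : SimpleGraph V) (c : ℕ) (l : V → ℕ) (v : V) :
    unlabelled (pivotStep G c l v) ⊆ unlabelled l := fun w hw => by
  rw [mem_unlabelled] at hw ⊢
  exact of_not_not fun h => pivotStep_ne_zero_of_ne_zero h hw

theorem closedPairs_pivotStep_subset [DecidableEq V] (G : SimpleGraph V) {c : ℕ} {l : V → ℕ}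
    (hc : ∀ w, l w < c) (v : V) :
    closedPairs G (pivotStep G c l v) ⊆
      closedPairs G l ∪ pairsIn (BadTriangle G v) (unlabelled l) := fun p hp => by
  have label_ne (w : V) : l w ≠ c := (hc w).ne
  have symm := G.adj_comm
  simp only [closedPairs, mem_union, mem_pairsIn, mem_unlabelled, disagreementGraph, pivotStep,
    BadTriangle, IsCherry, mem_univ, true_and] at hp ⊢
  grind

/-- The potential that compares the cost with that of a reference clustering `o`: a disagreement of
`o` that is removed from the vertices without a cluster pays for three closed pairs. -/
noncomputable def costPotential (G : SimpleGraph V) (o : V → α) (l : V → ℕ) : ℕ :=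
  #(closedPairs G l) + 3 * #(pairsIn (disagreementGraph G o).Adj (unlabelled l))

/-- The potential that bounds the number of `+` pairs among the vertices that are left without a
cluster after `i` pivots. -/
noncomputable def edgePotential (G : SimpleGraph V) (i : ℕ) (l : V → ℕ) : ℕ :=
  Fintype.card V * #(unlabelled l) + i * #(pairsIn G.Adj (unlabelled l))

theorem card_badTriangle_inf_add_le (G H : SimpleGraph V) {c : ℕ} (hc : c ≠ 0) {l : V → ℕ} {v : V}
    (hv : l v = 0) :
    #(pairsIn (BadTriangle G v ⊓ H.Adj) (unlabelled l)) +
        #(pairsIn H.Adj (unlabelled (pivotStep G c l v))) ≤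
      #(pairsIn H.Adj (unlabelled l)) := by
  classical
  rw [← card_union_of_disjoint]
  · refine card_le_card (union_subset (fun p hp => ?_)
      (pairsIn_mono _ (unlabelled_pivotStep_subset G c l v)))
    rw [mem_pairsIn] at hp ⊢
    exact ⟨hp.1, hp.2.1, hp.2.2.2⟩
  · refine disjoint_left.2 fun p hp hp' => ?_
    simp only [mem_pairsIn, mem_unlabelled] at hp hp'
    have labelled {w : V} (hw : l w = 0) (hvw : G.Adj v w) : pivotStep G c l v w ≠ 0 := by
      rwa [pivotStep, if_pos ⟨hv, hw, .inr hvw⟩]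
    rcases adj_left_or_adj_right_of_badTriangle hp.2.2.1 with h | h
    exacts [labelled hp.1 h hp'.1, labelled hp.2.1 h hp'.2.1]

theorem sum_costPotential_pivotStep_le (G : SimpleGraph V) (o : V → α) {c : ℕ} {l : V → ℕ}
    (hc : ∀ w, l w < c) :
    ∑ v ∈ unlabelled l, costPotential G o (pivotStep G c l v) ≤
      #(unlabelled l) * costPotential G o l := by
  classical
  set R := unlabelled l with hR
  have step : ∀ v ∈ R, costPotential G o (pivotStep G c l v) +
      3 * #(pairsIn (BadTriangle G v ⊓ (disagreementGraph G o).Adj) R) ≤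
        costPotential G o l + #(pairsIn (BadTriangle G v) R) := fun v hv => by
    have closed := (card_le_card (closedPairs_pivotStep_subset G hc v)).trans (card_union_le _ _)
    have remaining := card_badTriangle_inf_add_le G (disagreementGraph G o) (hc v).ne_bot
      (mem_unlabelled.1 hv)
    simp only [costPotential, ← hR] at closed remaining ⊢
    omega
  have total := sum_le_sum step
  have bad := sum_card_badTriangle_le G o R
  simp only [sum_add_distrib, ← mul_sum, sum_const, smul_eq_mul] at total
  omega

theorem card_unlabelled_pivotStep (G : SimpleGraph V) [DecidableRel G.Adj] {c : ℕ}
    (hc : c ≠ 0) {l : V → ℕ} {v : V} (hv : v ∈ unlabelled l) :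
    #(unlabelled (pivotStep G c l v)) + 1 + #{w ∈ unlabelled l | G.Adj v w} = #(unlabelled l) := by
  classical
  have cluster : {w ∈ unlabelled l | w = v ∨ G.Adj v w} =
      insert v {w ∈ unlabelled l | G.Adj v w} := by grind
  have rest : unlabelled (pivotStep G c l v) = {w ∈ unlabelled l | ¬(w = v ∨ G.Adj v w)} := by
    ext w
    simp only [mem_filter, mem_unlabelled, pivotStep] at hv ⊢
    grind
  have split := card_filter_add_card_filter_not (s := unlabelled l) fun w => w = v ∨ G.Adj v w
  rw [cluster, card_insert_of_notMem (by simp), ← rest] at split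
  omega

theorem sum_edgePotential_pivotStep_le (G : SimpleGraph V) (i : ℕ) {c : ℕ} (hc : c ≠ 0)
    (l : V → ℕ) :
    ∑ v ∈ unlabelled l, edgePotential G (i + 1) (pivotStep G c l v) +
        Fintype.card V * (#(unlabelled l) + #(pairsIn G.Adj (unlabelled l))) ≤
      #(unlabelled l) * edgePotential G (i + 1) l := by
  classical
  set R := unlabelled l
  have degree_sum : ∑ v ∈ R, #{w ∈ R | G.Adj v w} = #(pairsIn G.Adj R) := by
    rw [pairsIn, Rel.interedges, card_filter, sum_product]
    exact sum_congr rfl fun v _ => card_filter _ _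
  have step : ∀ v ∈ R, edgePotential G (i + 1) (pivotStep G c l v) +
      Fintype.card V * (1 + #{w ∈ R | G.Adj v w}) ≤ edgePotential G (i + 1) l := fun v hv => by
    have edges := Nat.mul_le_mul_left (i + 1)
      (card_le_card (pairsIn_mono G.Adj (unlabelled_pivotStep_subset G c l v)))
    have vertices := congrArg (Fintype.card V * ·) (card_unlabelled_pivotStep G hc hv)
    simp only [edgePotential, mul_add, add_assoc] at edges vertices ⊢
    linarith
  have total := sum_le_sum step
  simpa only [sum_add_distrib, ← mul_sum, sum_const, smul_eq_mul, mul_one, degree_sum] using total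

/-- `φ i l` does not increase in expectation when a uniformly random element of some set that
contains all vertices without a cluster is considered as the pivot number `i`. -/
def PivotPotential (G : SimpleGraph V) (φ : ℕ → (V → ℕ) → ℕ) : Prop :=
  ∀ ⦃i : ℕ⦄ ⦃l : V → ℕ⦄ ⦃A : Finset V⦄, (∀ w, l w ≤ i) → unlabelled l ⊆ A →
    ∑ v ∈ A, φ (i + 1) (pivotStep G (i + 1) l v) ≤ #A * φ i l

theorem sum_pivotStep_eq [DecidableEq V] (G : SimpleGraph V) (c : ℕ) {l : V → ℕ} {A : Finset V}
    (hA : unlabelled l ⊆ A) (f : (V → ℕ) → ℕ) :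
    ∑ v ∈ A, f (pivotStep G c l v) =
      #(A \ unlabelled l) * f l + ∑ v ∈ unlabelled l, f (pivotStep G c l v) := by
  rw [← sum_sdiff hA, ← smul_eq_mul, ← sum_const]
  congr 1
  refine sum_congr rfl fun v hv => ?_
  rw [pivotStep_eq_self G c fun h => (mem_sdiff.1 hv).2 (mem_unlabelled.2 h)]

theorem pivotPotential_costPotential (G : SimpleGraph V) (o : V → α) :
    PivotPotential G fun _ => costPotential G o := fun i l A hl hA => by
  classical
  rw [sum_pivotStep_eq G (i + 1) hA, ← card_sdiff_add_card_eq_card hA, add_mul]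
  gcongr
  exact sum_costPotential_pivotStep_le G o fun w => Nat.lt_succ_of_le (hl w)

theorem pivotPotential_edgePotential (G : SimpleGraph V) :
    PivotPotential G (edgePotential G) := fun i l A _ hA => by
  classical
  have sum_le := sum_edgePotential_pivotStep_le G i i.succ_ne_zero l
  have split := card_sdiff_add_card_eq_card hA
  have succ_eq : edgePotential G (i + 1) l =
      edgePotential G i l + #(pairsIn G.Adj (unlabelled l)) := by
    unfold edgePotential
    ring
  have hAV := Nat.mul_le_mul_right #(pairsIn G.Adj (unlabelled l)) (card_le_univ A)
  rw [sum_pivotStep_eq G (i + 1) hA]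
  rw [succ_eq] at sum_le ⊢
  rw [← split] at hAV ⊢
  nlinarith

end Pivots

section PivotSequences

open Finset

variable {n : ℕ} (G : SimpleGraph (Fin n))

/-- The labels after the first `i` entries of the sequence `p` have been considered as pivots;
entries that are not vertices are skipped. -/
noncomputable def pivotLabels (p : ℕ → ℕ) : ℕ → Fin n → ℕ
  | 0 => fun _ => 0
  | i + 1 =>
    if h : p i < n then pivotStep G (i + 1) (pivotLabels p i) ⟨p i, h⟩ else pivotLabels p i

variable {G}

theorem pivotLabels_succ {p : ℕ → ℕ} {i : ℕ} {v : Fin n} (hv : p i = v) :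
    pivotLabels G p (i + 1) = pivotStep G (i + 1) (pivotLabels G p i) v := by
  rw [pivotLabels, dif_pos (hv.trans_lt v.is_lt)]
  congr

theorem pivotLabels_congr {p q : ℕ → ℕ} {i : ℕ} (h : ∀ j < i, p j = q j) :
    pivotLabels G p i = pivotLabels G q i := by
  induction i with
  | zero => rfl
  | succ i ih =>
    have labels_eq := ih fun j hj => h j (hj.trans_le i.le_succ)
    simp only [pivotLabels, h i i.lt_succ_self, labels_eq]

theorem pivotLabels_le (p : ℕ → ℕ) (i : ℕ) (w : Fin n) : pivotLabels G p i w ≤ i := by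
  induction i with
  | zero => rfl
  | succ i ih =>
    rw [pivotLabels]
    split_ifs
    exacts [pivotStep_le (ih.trans i.le_succ), ih.trans i.le_succ]

theorem pivotLabels_ne_zero {p : ℕ → ℕ} {i j : ℕ} (hj : j < i) {w : Fin n} (hw : p j = w) :
    pivotLabels G p i w ≠ 0 := by
  induction i, hj using Nat.le_induction with
  | base =>
    rw [pivotLabels_succ hw]
    exact pivotStep_self_ne_zero j.succ_ne_zero
  | succ i _ ih =>
    rw [pivotLabels]
    split_ifs
    exacts [pivotStep_ne_zero_of_ne_zero ih, ih]

theorem sum_pivotLabels_update_le {φ : ℕ → (Fin n → ℕ) → ℕ} (hφ : PivotPotential G φ) {p f : ℕ → ℕ}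
    {i m : ℕ} (hlt : ∀ r < m, f r < n) (hinj : Set.InjOn f (Set.Iio m))
    (hcover : ∀ x < n, (∀ j < i, p j ≠ x) → ∃ r < m, f r = x) :
    ∑ r ∈ range m, φ (i + 1) (pivotLabels G (Function.update p i (f r)) (i + 1)) ≤
      m * φ i (pivotLabels G p i) := by
  rw [← coe_range] at hinj
  let A : Finset (Fin n) := ((range m).image f).attachFin fun x hx => by
    obtain ⟨r, hr, rfl⟩ := mem_image.1 hx
    exact hlt r (mem_range.1 hr)
  have cardA : #A = m := by rw [card_attachFin, card_image_of_injOn hinj, card_range]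
  have unlabelled_subset : unlabelled (pivotLabels G p i) ⊆ A := fun w hw => by
    have fresh := fun j hj e => pivotLabels_ne_zero (j := j) hj e (mem_unlabelled.1 hw)
    obtain ⟨r, hr, hrw⟩ := hcover w w.2 fresh
    exact mem_attachFin _ |>.2 (mem_image.2 ⟨r, mem_range.2 hr, hrw⟩)
  have step (v : Fin n) : pivotLabels G (Function.update p i v) (i + 1) =
      pivotStep G (i + 1) (pivotLabels G p i) v := by
    rw [pivotLabels_succ (Function.update_self i _ p),
      pivotLabels_congr fun j hj => Function.update_of_ne hj.ne _ p]
  calc ∑ r ∈ range m, φ (i + 1) (pivotLabels G (Function.update p i (f r)) (i + 1))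
    _ = ∑ x ∈ A.map Fin.valEmbedding,
          φ (i + 1) (pivotLabels G (Function.update p i x) (i + 1)) := by
      rw [map_valEmbedding_attachFin, sum_image hinj]
    _ = ∑ v ∈ A, φ (i + 1) (pivotStep G (i + 1) (pivotLabels G p i) v) := by
      simp only [sum_map, Fin.valEmbedding_apply, step]
    _ ≤ m * φ i (pivotLabels G p i) := cardA ▸ hφ (pivotLabels_le p i) unlabelled_subset

theorem costPotential_zero (o : Fin n → ℕ) :
    costPotential G o (fun _ => 0) = 2 * (3 * clusteringCost G o) := by
  have closed : closedPairs G (fun _ => 0) = ∅ :=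
    eq_empty_of_forall_notMem fun _ hp => (mem_pairsIn.1 hp).2.2.2 ⟨rfl, rfl⟩
  rw [costPotential, closed, card_empty, unlabelled, filter_true_of_mem fun _ _ => rfl,
    ← two_mul_clusteringCost]
  ring

theorem edgePotential_zero : edgePotential G 0 (fun _ => 0) = n ^ 2 := by
  simp [edgePotential, unlabelled, sq]

theorem exists_clusteringCost_eq_optCost : ∃ o, clusteringCost G o = optCost G :=
  Nat.sInf_mem (Set.range_nonempty (clusteringCost G))

end PivotSequences

section Expectation

variable {σ ρ : Type}

theorem expectedValue_pure (s : σ) (f : σ → ℝ≥0∞) : expectedValue (PMF.pure s) f = f s := by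
  classical
  simp [expectedValue, PMF.pure_apply]

theorem expectedValue_mono {p : PMF σ} {f g : σ → ℝ≥0∞} (h : ∀ s ∈ p.support, f s ≤ g s) :
    expectedValue p f ≤ expectedValue p g := by
  refine ENNReal.tsum_le_tsum fun s => ?_
  by_cases hs : s ∈ p.support
  · gcongr
    exact h s hs
  · rw [p.apply_eq_zero_iff s |>.2 hs, zero_mul, zero_mul]

theorem expectedValue_const (p : PMF σ) (b : ℝ≥0∞) : expectedValue p (fun _ => b) = b := by
  rw [expectedValue, ENNReal.tsum_mul_right, p.tsum_coe, one_mul]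

theorem expectedValue_const_mul (p : PMF σ) (b : ℝ≥0∞) (f : σ → ℝ≥0∞) :
    expectedValue p (fun s => b * f s) = b * expectedValue p f := by
  simp only [expectedValue, ← ENNReal.tsum_mul_left, mul_left_comm]

theorem expectedValue_add (p : PMF σ) (f g : σ → ℝ≥0∞) :
    expectedValue p (fun s => f s + g s) = expectedValue p f + expectedValue p g := by
  simp only [expectedValue, mul_add, ENNReal.tsum_add]

theorem expectedValue_bind (p : PMF σ) (q : σ → PMF ρ) (f : ρ → ℝ≥0∞) :
    expectedValue (p.bind q) f = expectedValue p fun s => expectedValue (q s) f := by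
  simp only [expectedValue, PMF.bind_apply, ← ENNReal.tsum_mul_right, ← ENNReal.tsum_mul_left]
  rw [ENNReal.tsum_comm]
  simp only [mul_assoc]

theorem expectedValue_map (p : PMF σ) (q : σ → ρ) (f : ρ → ℝ≥0∞) :
    expectedValue (p.map q) f = expectedValue p fun s => f (q s) := by
  simp only [PMF.map, expectedValue_bind, Function.comp_apply, expectedValue_pure]

theorem expectedValue_le_of_support {p : PMF σ} {f : σ → ℝ≥0∞} {b : ℝ≥0∞}
    (h : ∀ s ∈ p.support, f s ≤ b) : expectedValue p f ≤ b :=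
  (expectedValue_mono h).trans_eq (expectedValue_const p b)

theorem uniformBelow_of_pos {m : ℕ} (hm : 0 < m) :
    uniformBelow m = PMF.uniformOfFinset (Finset.range m) (Finset.nonempty_range_iff.2 hm.ne') :=
  dif_pos hm

theorem lt_of_mem_support_uniformBelow {m r : ℕ} (hm : 0 < m) (h : r ∈ (uniformBelow m).support) :
    r < m := by
  rw [uniformBelow_of_pos hm, PMF.mem_support_uniformOfFinset_iff] at h
  exact Finset.mem_range.1 h

theorem expectedValue_uniformBelow {m : ℕ} (hm : 0 < m) (f : ℕ → ℝ≥0∞) :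
    expectedValue (uniformBelow m) f = (∑ r ∈ Finset.range m, f r) / m := by
  rw [expectedValue, uniformBelow_of_pos hm, tsum_eq_sum (s := Finset.range m),
    ENNReal.div_eq_inv_mul, Finset.mul_sum]
  · refine Finset.sum_congr rfl fun r hr => ?_
    rw [PMF.uniformOfFinset_apply_of_mem _ hr, Finset.card_range]
  · intro r hr
    rw [PMF.uniformOfFinset_apply_of_notMem _ hr, zero_mul]

theorem support_iterateFor {f : ℕ → σ → PMF σ} {I : ℕ → σ → Prop} {m : ℕ}
    (hI : ∀ i < m, ∀ s, I i s → ∀ t ∈ (f i s).support, I (i + 1) t) {s : σ} (h0 : I 0 s) :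
    ∀ t ∈ (iterateFor f m s).support, I m t := by
  induction m with
  | zero => simpa [iterateFor] using h0
  | succ m ih =>
    intro t ht
    obtain ⟨u, hu, ht⟩ := (PMF.mem_support_bind_iff _ _ _).1 ht
    exact hI m m.lt_succ_self u (ih (fun i hi => hI i (hi.trans_le m.le_succ)) u hu) t ht

theorem expectedValue_iterateFor_le {f : ℕ → σ → PMF σ} {I : ℕ → σ → Prop} {φ : ℕ → σ → ℝ≥0∞}
    {m : ℕ} (hI : ∀ i < m, ∀ s, I i s → ∀ t ∈ (f i s).support, I (i + 1) t)
    (hφ : ∀ i < m, ∀ s, I i s → expectedValue (f i s) (φ (i + 1)) ≤ φ i s) {s : σ} (h0 : I 0 s) :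
    expectedValue (iterateFor f m s) (φ m) ≤ φ 0 s := by
  induction m with
  | zero => exact (expectedValue_pure s (φ 0)).le
  | succ m ih =>
    have hI' := fun i (hi : i < m) => hI i (hi.trans_le m.le_succ)
    rw [iterateFor, expectedValue_bind]
    refine (expectedValue_mono fun u hu => ?_).trans
      (ih hI' fun i hi => hφ i (hi.trans_le m.le_succ))
    exact hφ m m.lt_succ_self u (support_iterateFor hI' h0 u hu)

theorem eq_pure_of_support_subset_singleton {p : PMF σ} {a : σ} (h : p.support ⊆ {a}) :
    p = PMF.pure a := by
  have support_eq := p.support_nonempty.subset_singleton_iff.1 h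
  ext x
  by_cases hx : x = a
  · rw [hx, (p.apply_eq_one_iff a).2 support_eq, PMF.pure_apply_self]
  · rw [(p.apply_eq_zero_iff x).2 fun hs => hx (h hs), PMF.pure_apply_of_ne _ _ hx]

end Expectation

attribute [simps] Config.tick Config.setReg Config.setTab Config.addRequest Config.answerRequests

theorem Expr.eval_tick {ι τ : Type} (a : Expr ι τ) (s : Config ι τ) (m : ℕ) :
    a.eval (s.tick m) = a.eval s := by
  induction a <;> simp_all [eval]

namespace Cmd

variable {ι τ : Type}

/-- The expressions that bound the loops of a command. -/
def ranges : Cmd ι τ → List (Expr ι τ)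
  | seq c d => c.ranges ++ d.ranges
  | when _ c => c.ranges
  | loop _ a c => a :: c.ranges
  | _ => []

/-- The number of steps of a command when all tests succeed and the expressions that bound its loops
keep the values that they have in `s`. -/
def maxTime (s : Config ι τ) : Cmd ι τ → ℕ
  | set _ a => a.steps + 1
  | put _ a b c => a.steps + b.steps + c.steps + 1
  | rand _ a => a.steps + 1
  | ask a b => a.steps + b.steps + 1
  | seq c d => c.maxTime s + d.maxTime s
  | when a c => a.steps + 1 + c.maxTime s
  | loop _ a c => a.steps + 1 + a.eval s * (1 + c.maxTime s)

theorem maxTime_congr {c : Cmd ι τ} {s t : Config ι τ} (h : ∀ a ∈ c.ranges, a.eval t = a.eval s) :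
    c.maxTime t = c.maxTime s := by
  induction c with
  | seq c d ihc ihd =>
    simp only [ranges, List.mem_append] at h
    rw [maxTime, maxTime, ihc fun a ha => h a (.inl ha), ihd fun a ha => h a (.inr ha)]
  | when a c ih => rw [maxTime, maxTime, ih h]
  | loop x a c ih =>
    simp only [ranges, List.mem_cons] at h
    rw [maxTime, maxTime, h a (.inl rfl), ih fun b hb => h b (.inr hb)]
  | _ => rfl

variable [DecidableEq ι] [DecidableEq τ]

/-- Every possible final configuration of the command satisfies `P`. -/
def Ensures (c : Cmd ι τ) (s : Config ι τ) (P : Config ι τ → Prop) : Prop :=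
  ∀ t ∈ (c.run s).support, P t

variable {c d : Cmd ι τ} {a b e : Expr ι τ} {x : ι} {s : Config ι τ} {P P' : Config ι τ → Prop}

theorem Ensures.mono (h : c.Ensures s P) (hP : ∀ t, P t → P' t) : c.Ensures s P' :=
  fun t ht => hP t (h t ht)

theorem Ensures.and (h : c.Ensures s P) (h' : c.Ensures s P') :
    c.Ensures s fun t => P t ∧ P' t :=
  fun t ht => ⟨h t ht, h' t ht⟩

theorem ensures_set :
    (set x a : Cmd ι τ).Ensures s P ↔ P ((s.setReg x (a.eval s)).tick (a.steps + 1)) := by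
  simp [Ensures, run]

theorem ensures_put {t : τ} :
    (put t a b e : Cmd ι τ).Ensures s P ↔
      P ((s.setTab t (a.eval s) (b.eval s) (e.eval s)).tick (a.steps + b.steps + e.steps + 1)) := by
  simp [Ensures, run]

theorem ensures_ask :
    (ask a b : Cmd ι τ).Ensures s P ↔
      P ((s.addRequest (a.eval s) (b.eval s)).tick (a.steps + b.steps + 1)) := by
  simp [Ensures, run]

theorem ensures_rand :
    (rand x a : Cmd ι τ).Ensures s P ↔
      ∀ r ∈ (uniformBelow (a.eval s)).support, P ((s.setReg x r).tick (a.steps + 1)) := by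
  simp [Ensures, run]

theorem ensures_seq : (seq c d).Ensures s P ↔ c.Ensures s fun t => d.Ensures t P := by
  simp only [Ensures, run, PMF.mem_support_bind_iff]
  exact ⟨fun h t ht u hu => h u ⟨t, ht, hu⟩, fun h u ⟨t, ht, hu⟩ => h t ht u hu⟩

theorem ensures_when :
    (when a c).Ensures s P ↔
      (a.eval s ≠ 0 → c.Ensures (s.tick (a.steps + 1)) P) ∧
        (a.eval s = 0 → P (s.tick (a.steps + 1))) := by
  by_cases h : a.eval s = 0 <;> simp [Ensures, run, h]

theorem ensures_loop (I : ℕ → Config ι τ → Prop) (h0 : I 0 (s.tick (a.steps + 1)))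
    (hI : ∀ i < a.eval s, ∀ t, I i t → c.Ensures ((t.setReg x i).tick 1) (I (i + 1))) :
    (loop x a c).Ensures s (I (a.eval s)) :=
  support_iterateFor (fun i hi t ht => hI i hi t ht) h0

theorem expectedValue_rand_seq_le {f : Config ι τ → ℝ≥0∞} {b : ℝ≥0∞} {h : ℕ → ℝ≥0∞}
    (ha : 0 < a.eval s)
    (hc : ∀ r < a.eval s, c.Ensures ((s.setReg x r).tick (a.steps + 1)) fun t => f t ≤ h r)
    (hb : ∑ r ∈ Finset.range (a.eval s), h r ≤ a.eval s * b) :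
    expectedValue ((seq (rand x a) c).run s) f ≤ b := by
  rw [run, expectedValue_bind, run, expectedValue_map, expectedValue_uniformBelow ha]
  refine ENNReal.div_le_of_le_mul' (le_trans (Finset.sum_le_sum fun r hr => ?_) hb)
  exact expectedValue_le_of_support (hc r (Finset.mem_range.1 hr))

/-- No instruction of the command changes the value of `f`. This is a syntactic condition, hence
easily checked for a given program. -/
def Fixes {α : Type*} (f : Config ι τ → α) : Cmd ι τ → Prop
  | set x _ => ∀ s m, f (s.setReg x m) = f s
  | put t _ _ _ => ∀ s a b m, f (s.setTab t a b m) = f s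
  | rand x _ => ∀ s m, f (s.setReg x m) = f s
  | ask _ _ => ∀ s a b, f (s.addRequest a b) = f s
  | seq c d => c.Fixes f ∧ d.Fixes f
  | when _ c => c.Fixes f
  | loop x _ c => (∀ s m, f (s.setReg x m) = f s) ∧ c.Fixes f

theorem Fixes.ensures {α : Type*} {f : Config ι τ → α} (hc : c.Fixes f)
    (htick : ∀ s m, f (s.tick m) = f s) (s : Config ι τ) : c.Ensures s fun t => f t = f s := by
  induction c generalizing s with
  | set => rw [ensures_set, htick, hc]
  | put => rw [ensures_put, htick, hc]
  | rand => exact ensures_rand.2 fun r _ => by rw [htick, hc]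
  | ask => rw [ensures_ask, htick, hc]
  | seq c d ihc ihd =>
    exact ensures_seq.2 ((ihc hc.1 s).mono fun t ht => ht ▸ ihd hc.2 t)
  | when a c ih => exact ensures_when.2 ⟨fun _ => htick s _ ▸ ih hc _, fun _ => htick s _⟩
  | loop x a c ih =>
    refine ensures_loop (fun _ t => f t = f s) (htick s _) fun i _ t ht => ?_
    rw [← ht, ← hc.1 t i, ← htick _ 1]
    exact ih hc.2 _

theorem Fixes.map_run {α : Type} {f : Config ι τ → α} (hc : c.Fixes f)
    (htick : ∀ s m, f (s.tick m) = f s) (s : Config ι τ) :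
    (c.run s).map f = PMF.pure (f s) := by
  refine eq_pure_of_support_subset_singleton fun x hx => ?_
  obtain ⟨t, ht, rfl⟩ := (PMF.mem_support_map_iff _ _ _).1 hx
  exact hc.ensures htick s t ht

theorem Fixes.ensures_loop {α : Type*} {f : Config ι τ → α} (hc : (loop x a c).Fixes f)
    (htick : ∀ s m, f (s.tick m) = f s) (I : ℕ → Config ι τ → Prop)
    (h0 : I 0 (s.tick (a.steps + 1)))
    (hI : ∀ i < a.eval s, ∀ t, f t = f s → I i t →
      c.Ensures ((t.setReg x i).tick 1) (I (i + 1))) :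
    (loop x a c).Ensures s (I (a.eval s)) := by
  refine (Cmd.ensures_loop (fun i t => f t = f s ∧ I i t) ⟨htick s _, h0⟩
    fun i hi t ht => .and ?_ (hI i hi t ht.1 ht.2)).mono fun t ht => ht.2
  rw [← ht.1, ← hc.1 t i, ← htick _ 1]
  exact hc.2.ensures htick _

theorem ensures_time_le (hc : ∀ a ∈ c.ranges, c.Fixes a.eval) (s : Config ι τ) :
    c.Ensures s fun t => t.time ≤ s.time + c.maxTime s := by
  induction c generalizing s with
  | set => exact ensures_set.2 le_rfl
  | put => exact ensures_put.2 le_rfl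
  | rand => exact ensures_rand.2 fun _ _ => le_rfl
  | ask => exact ensures_ask.2 le_rfl
  | seq c d ihc ihd =>
    simp only [ranges, List.mem_append] at hc
    refine ensures_seq.2 fun t ht => ?_
    have fixed : ∀ a ∈ d.ranges, a.eval t = a.eval s := fun a ha =>
      (hc a (.inr ha)).1.ensures a.eval_tick s t ht
    refine (ihd (fun a ha => (hc a (.inr ha)).2) t).mono fun u hu => ?_
    have first := ihc (fun a ha => (hc a (.inl ha)).1) s t ht
    rw [maxTime_congr fixed] at hu
    rw [maxTime]
    omega
  | when a c ih =>
    refine ensures_when.2 ⟨fun _ => (ih hc _).mono fun t ht => ?_, fun _ => ?_⟩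
    · rw [maxTime_congr fun b _ => b.eval_tick s _] at ht
      rwa [maxTime, ← add_assoc]
    · rw [maxTime, ← add_assoc]
      exact Nat.le_add_right _ _
  | loop x a c ih =>
    simp only [ranges, List.mem_cons, forall_eq_or_imp] at hc
    let I (i : ℕ) (t : Config ι τ) : Prop := (∀ b ∈ c.ranges, b.eval t = b.eval s) ∧
      t.time ≤ s.time + (a.steps + 1 + i * (1 + c.maxTime s))
    have start : I 0 (s.tick (a.steps + 1)) := ⟨fun b _ => b.eval_tick s _, by simp⟩
    refine (ensures_loop I start fun i _ t ht => ?_).mono fun t ht => ht.2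
    have entry : ∀ b ∈ c.ranges, b.eval ((t.setReg x i).tick 1) = b.eval s := fun b hb =>
      (b.eval_tick _ _).trans (((hc.2 b hb).1 t i).trans (ht.1 b hb))
    refine fun u hu => ⟨fun b hb => ?_, ?_⟩
    · rw [← entry b hb]
      exact (hc.2 b hb).2.ensures b.eval_tick _ u hu
    · have body := ih (fun b hb => (hc.2 b hb).2) _ u hu
      rw [maxTime_congr entry, Config.tick_time, Config.setReg_time] at body
      rw [add_one_mul]
      omega

end Cmd

namespace NAQECC

open Expr Cmd

/-! ### The sample size -/

/-- The number `k = max {t ≤ n ∣ (2 n - 1 - t) t ≤ 2 Q}` of sampled vertices. -/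
def sampleSize (n Q : ℕ) : ℕ := Nat.findGreatest (fun t => (2 * n - 1 - t) * t ≤ 2 * Q) n

theorem sampleSize_le (n Q : ℕ) : sampleSize n Q ≤ n := Nat.findGreatest_le n

theorem sampleSize_spec (n Q : ℕ) : (2 * n - 1 - sampleSize n Q) * sampleSize n Q ≤ 2 * Q :=
  Nat.findGreatest_spec (P := fun t => (2 * n - 1 - t) * t ≤ 2 * Q) n.zero_le (by simp)

theorem le_sampleSize {n Q t : ℕ} (hn : t ≤ n) (hQ : (2 * n - 1 - t) * t ≤ 2 * Q) :
    t ≤ sampleSize n Q :=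
  Nat.le_findGreatest hn hQ

theorem sampleSize_le_succ (n Q : ℕ) : sampleSize n Q ≤ Q + 1 := by
  have le_n := sampleSize_le n Q
  have spec := sampleSize_spec n Q
  by_contra! hlt
  have : (Q + 1) * (Q + 2) ≤ 2 * Q := (Nat.mul_le_mul (by omega) (by omega)).trans spec
  nlinarith

theorem sampleSize_mul_le (n Q : ℕ) : sampleSize n Q * n ≤ 3 * Q + 1 := by
  have le_n := sampleSize_le n Q
  have pred_mul_le : (n - 1) * sampleSize n Q ≤ 2 * Q :=
    (Nat.mul_le_mul_right _ (by omega)).trans (sampleSize_spec n Q)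
  have le_succ := sampleSize_le_succ n Q
  cases n with
  | zero => simp
  | succ n =>
    rw [Nat.add_sub_cancel, mul_comm] at pred_mul_le
    rw [mul_add_one]
    omega

theorem le_succ_sampleSize_mul {n Q : ℕ} (h : sampleSize n Q < n) :
    Q ≤ (sampleSize n Q + 1) * n := by
  by_contra! hlt
  refine (le_sampleSize (t := sampleSize n Q + 1) h ?_).not_gt (Nat.lt_succ_self _)
  calc (2 * n - 1 - (sampleSize n Q + 1)) * (sampleSize n Q + 1)
    _ ≤ 2 * n * (sampleSize n Q + 1) := Nat.mul_le_mul_right _ (by omega)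
    _ ≤ 2 * Q := by nlinarith

theorem ensures_computeK (s : Config Reg Tab) :
    computeK.Ensures s fun t => t.reg .k = sampleSize (s.reg .n) (s.reg .Q) := by
  set K := sampleSize (s.reg .n) (s.reg .Q)
  have fixed : computeK.Fixes fun t : Config Reg Tab => (t.reg .n, t.reg .Q) := by
    simp [computeK, Fixes]
  refine (fixed.ensures_loop (fun _ _ => rfl) (fun i t => K < i → t.reg .k = K) (by simp)
    fun i _ t ht hk => ?_).mono fun t ht => ht ?_
  · simp only [Prod.mk.injEq] at ht
    simp only [ensures_when, ensures_set, eval, Config.tick_reg, Config.setReg_reg,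
      Function.update_self, ne_eq, reduceCtorEq, not_false_eq_true, Function.update_of_ne,
      ite_eq_right_iff, one_ne_zero, imp_false, not_not, ht]
    have le_K (hn : i ≤ s.reg .n) (hQ : (2 * s.reg .n - 1 - i) * i ≤ 2 * s.reg .Q) : i ≤ K :=
      le_sampleSize hn hQ
    have admissible : K ≤ s.reg .n ∧ (2 * s.reg .n - 1 - K) * K ≤ 2 * s.reg .Q :=
      ⟨sampleSize_le _ _, sampleSize_spec _ _⟩
    grind
  · have := sampleSize_le_succ (s.reg .n) (s.reg .Q)
    simp only [eval]
    omega

/-! ### Drawing the sample -/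

/-- The number of choices for the next vertex of the sample, as an expression of the program. -/
def choices : Sampling → Expr Reg Tab
  | .withReplacement => var .n
  | .withoutReplacement => sub (var .n) (var .i)

/-- The part of the program that stores the vertex determined by a random choice. -/
def storeChoice : Sampling → Cmd Reg Tab
  | .withReplacement => .put .sample (var .i) (const 0) (var .r)
  | .withoutReplacement =>
      .seq (.set .r (add (var .i) (var .r))) <|
      .seq (.set .v (get .swap (var .r) (const 0))) <|
      .seq (.when (eq (var .v) (const 0)) (.set .v (add (var .r) (const 1)))) <|
      .seq (.set .u (get .swap (var .i) (const 0))) <|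
      .seq (.when (eq (var .u) (const 0)) (.set .u (add (var .i) (const 1)))) <|
      .seq (.put .swap (var .r) (const 0) (var .u)) <|
      .put .sample (var .i) (const 0) (sub (var .v) (const 1))

/-- The part of the program that draws one vertex. -/
def drawVertex (sampling : Sampling) : Cmd Reg Tab :=
  .seq (.rand .r (choices sampling)) (storeChoice sampling)

theorem drawSample_eq (sampling : Sampling) :
    drawSample sampling = .loop .i (var .k) (drawVertex sampling) := by
  cases sampling <;> rfl

/-- The sequence of sampled vertices stored in a configuration. -/
def samples (s : Config Reg Tab) (j : ℕ) : ℕ := s.tab .sample j 0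

/-- The entry at position `j` of the shuffled list; see `Tab.swap` for its encoding. -/
def entry (s : Config Reg Tab) (j : ℕ) : ℕ := if s.tab .swap j 0 = 0 then j else s.tab .swap j 0 - 1

/-- The number of choices for the vertex with index `i` of the sample. -/
def choiceCount : Sampling → ℕ → ℕ → ℕ
  | .withReplacement, n, _ => n
  | .withoutReplacement, n, i => n - i

/-- The vertex with index `i` of the sample if the outcome of the random choice is `r`. -/
def choice : Sampling → Config Reg Tab → ℕ → ℕ → ℕ
  | .withReplacement, _, _, r => r
  | .withoutReplacement, s, i, r => entry s (i + r)

theorem choiceCount_pos {n i : ℕ} (sampling : Sampling) (h : i < n) :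
    0 < choiceCount sampling n i := by
  cases sampling with
  | withReplacement => exact h.pos
  | withoutReplacement => exact Nat.sub_pos_of_lt h

/-- The positions `i, …, n - 1` of the list `e` hold the numbers below `n` that do not occur among
the first `i` entries of `p`: the invariant of the Fisher–Yates shuffle. -/
structure Shuffled (n i : ℕ) (p e : ℕ → ℕ) : Prop where
  lt : ∀ j, i ≤ j → j < n → e j < n
  inj : ∀ j, i ≤ j → j < n → ∀ j', i ≤ j' → j' < n → e j = e j' → j = j'
  cover : ∀ x < n, (∀ j < i, p j ≠ x) → ∃ j, i ≤ j ∧ j < n ∧ e j = x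

theorem Shuffled.swap {n i r : ℕ} {p e : ℕ → ℕ} (h : Shuffled n i p e) (hr : r < n - i) :
    Shuffled n (i + 1) (Function.update p i (e (i + r))) (Function.update e (i + r) (e i)) where
  lt j hj hjn := by
    rw [Function.update_apply]
    split_ifs
    exacts [h.lt i le_rfl (by omega), h.lt j (by omega) hjn]
  inj j hj hjn j' hj' hjn' := by
    have inj := h.inj
    simp only [Function.update_apply]
    grind
  cover x hx hnew := by
    have fresh : ∀ j < i, p j ≠ x := fun j hj => by simpa [hj.ne] using hnew j (by omega)
    obtain ⟨j, hij, hjn, rfl⟩ := h.cover x hx fresh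
    have ne : e (i + r) ≠ e j := by simpa using hnew i i.lt_succ_self
    rcases hij.eq_or_lt with rfl | hij
    · exact ⟨i + r, by grind, by omega, Function.update_self ..⟩
    · exact ⟨j, hij, hjn, Function.update_of_ne (by grind) _ _⟩

/-- The configurations in which `i` vertices have been drawn. -/
structure Drawn (sampling : Sampling) (n i : ℕ) (s : Config Reg Tab) : Prop where
  reg_n : s.reg .n = n
  samples_lt : ∀ j < i, samples s j < n
  shuffled : sampling = .withoutReplacement → Shuffled n i (samples s) (entry s)

namespace Drawn

variable {sampling : Sampling} {n i r : ℕ} {s : Config Reg Tab}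

theorem choice_lt (hs : Drawn sampling n i s) (hr : r < choiceCount sampling n i) :
    choice sampling s i r < n := by
  cases sampling with
  | withReplacement => exact hr
  | withoutReplacement =>
    exact (hs.shuffled rfl).lt _ (i.le_add_right r) (Nat.add_lt_of_lt_sub' hr)

theorem injOn_choice (hs : Drawn sampling n i s) :
    Set.InjOn (choice sampling s i) (Set.Iio (choiceCount sampling n i)) := by
  cases sampling with
  | withReplacement => exact fun _ _ _ _ h => h
  | withoutReplacement =>
    intro r hr r' hr' h
    have hlt (m : ℕ) (hm : m < n - i) := Nat.add_lt_of_lt_sub' hm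
    exact Nat.add_left_cancel <|
      (hs.shuffled rfl).inj _ (i.le_add_right r) (hlt r hr) _ (i.le_add_right r') (hlt r' hr') h

theorem exists_choice_eq (hs : Drawn sampling n i s) {x : ℕ} (hx : x < n)
    (hnew : ∀ j < i, samples s j ≠ x) :
    ∃ r < choiceCount sampling n i, choice sampling s i r = x := by
  cases sampling with
  | withReplacement => exact ⟨x, hx, rfl⟩
  | withoutReplacement =>
    obtain ⟨j, hij, hjn, hj⟩ := (hs.shuffled rfl).cover x hx hnew
    refine ⟨j - i, Nat.sub_lt_sub_right hij hjn, ?_⟩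
    rw [choice, Nat.add_sub_cancel' hij, hj]

end Drawn

theorem ensures_storeChoice (sampling : Sampling) {i r : ℕ} {s : Config Reg Tab}
    (hi : s.reg .i = i) (hr : s.reg .r = r) :
    (storeChoice sampling).Ensures s fun t =>
      samples t = Function.update (samples s) i (choice sampling s i r) ∧
      (sampling = .withoutReplacement →
        entry t = Function.update (entry s) (i + r) (entry s i)) := by
  subst hi hr
  cases sampling with
  | withReplacement =>
    refine ensures_put.2 ⟨funext fun j => ?_, fun h => nomatch h⟩
    by_cases hj : j = s.reg .i <;> simp [samples, choice, eval, hj]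
  | withoutReplacement =>
    simp only [storeChoice, ensures_seq, ensures_set, ensures_when, ensures_put]
    constructor <;> intro hv <;> constructor <;> intro hu
    all_goals
      simp only [eval, Config.tick_reg, Config.setReg_reg, Function.update_self, Config.tick_tab,
        Config.setReg_tab, ite_eq_right_iff, one_ne_zero, imp_false, ne_eq, reduceCtorEq,
        not_false_eq_true, Function.update_of_ne, Decidable.not_not] at hv hu
      refine ⟨funext fun j => ?_, fun _ => funext fun j => ?_⟩
      · by_cases hj : j = s.reg .i <;> simp [samples, choice, entry, eval, hj, hv]
      · by_cases hj : j = s.reg .i + s.reg .r <;> simp [entry, eval, hj, hu]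

section Drawing

variable {sampling : Sampling} {n i : ℕ} {s : Config Reg Tab}

theorem storeChoice_fixes_reg_n (sampling : Sampling) :
    (storeChoice sampling).Fixes fun s => s.reg .n := by
  cases sampling <;> simp [storeChoice, Fixes]

theorem eval_choices (hn : s.reg .n = n) :
    (choices sampling).eval ((s.setReg .i i).tick 1) = choiceCount sampling n i := by
  cases sampling <;> simp [choices, choiceCount, eval, hn]

theorem Drawn.ensures_storeChoice {r : ℕ} (hs : Drawn sampling n i s)
    (hr : r < choiceCount sampling n i) (m : ℕ) :
    (storeChoice sampling).Ensures ((((s.setReg .i i).tick 1).setReg .r r).tick m) fun t =>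
      Drawn sampling n (i + 1) t ∧
        samples t = Function.update (samples s) i (choice sampling s i r) := by
  have stored := (NAQECC.ensures_storeChoice sampling (i := i) (r := r)
    (s := (((s.setReg .i i).tick 1).setReg .r r).tick m) (by simp) (by simp)).and <|
      (storeChoice_fixes_reg_n sampling).ensures (fun _ _ => rfl) _
  refine stored.mono fun t ⟨⟨samples_eq, entry_eq⟩, n_eq⟩ => ?_
  have samples_eq : samples t = Function.update (samples s) i (choice sampling s i r) := by
    cases sampling <;> exact samples_eq
  refine ⟨⟨?_, fun j hj => ?_, ?_⟩, samples_eq⟩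
  · simp [n_eq, hs.reg_n]
  · rw [samples_eq, Function.update_apply]
    split_ifs
    exacts [hs.choice_lt hr, hs.samples_lt j (by omega)]
  · rintro rfl
    rw [samples_eq, entry_eq rfl]
    exact (hs.shuffled rfl).swap hr

theorem Drawn.ensures_drawVertex (hs : Drawn sampling n i s) (hi : i < n) :
    (drawVertex sampling).Ensures ((s.setReg .i i).tick 1) (Drawn sampling n (i + 1)) := by
  refine ensures_seq.2 (ensures_rand.2 fun r hr => ?_)
  rw [eval_choices hs.reg_n] at hr
  have hr := lt_of_mem_support_uniformBelow (choiceCount_pos sampling hi) hr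
  exact (hs.ensures_storeChoice hr _).mono fun t ht => ht.1

theorem drawn_zero (sampling : Sampling) (hn : s.reg .n = n) (htab : s.tab = fun _ _ _ => 0) :
    Drawn sampling n 0 s where
  reg_n := hn
  samples_lt _ hj := absurd hj (Nat.not_lt_zero _)
  shuffled _ := by
    have entry_eq : entry s = id := funext fun j => by simp [entry, htab]
    rw [entry_eq]
    exact ⟨fun j _ hj => hj, fun j _ _ j' _ _ h => h, fun x hx _ => ⟨x, x.zero_le, hx, rfl⟩⟩

theorem ensures_drawSample (sampling : Sampling) (hn : s.reg .n = n) (hk : s.reg .k ≤ n)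
    (htab : s.tab = fun _ _ _ => 0) :
    (drawSample sampling).Ensures s (Drawn sampling n (s.reg .k)) := by
  rw [drawSample_eq]
  exact ensures_loop (Drawn sampling n) (drawn_zero sampling hn htab) fun i hi t ht =>
    ht.ensures_drawVertex (hi.trans_le hk)

variable {G : SimpleGraph (Fin n)} {φ : ℕ → (Fin n → ℕ) → ℕ}

theorem Drawn.expectedValue_drawVertex_le (hs : Drawn sampling n i s) (hi : i < n)
    (hφ : PivotPotential G φ) :
    expectedValue ((drawVertex sampling).run ((s.setReg .i i).tick 1))
        (fun t => (φ (i + 1) (pivotLabels G (samples t) (i + 1)) : ℝ≥0∞)) ≤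
      φ i (pivotLabels G (samples s) i) := by
  refine expectedValue_rand_seq_le (h := fun r => (φ (i + 1) (pivotLabels G
    (Function.update (samples s) i (choice sampling s i r)) (i + 1)) : ℝ≥0∞)) ?_ ?_ ?_
  all_goals rw [eval_choices hs.reg_n]
  · exact choiceCount_pos sampling hi
  · exact fun r hr => (hs.ensures_storeChoice hr _).mono fun t ht => by rw [ht.2]
  · exact_mod_cast sum_pivotLabels_update_le hφ (fun _ => hs.choice_lt) hs.injOn_choice
      fun _ => hs.exists_choice_eq

theorem expectedValue_drawSample_le (sampling : Sampling) (hφ : PivotPotential G φ)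
    (hn : s.reg .n = n) (hk : s.reg .k ≤ n) (htab : s.tab = fun _ _ _ => 0) :
    expectedValue ((drawSample sampling).run s)
        (fun t => (φ (s.reg .k) (pivotLabels G (samples t) (s.reg .k)) : ℝ≥0∞)) ≤
      φ 0 (fun _ => 0) := by
  rw [drawSample_eq]
  exact expectedValue_iterateFor_le (I := Drawn sampling n)
    (φ := fun i t => (φ i (pivotLabels G (samples t) i) : ℝ≥0∞))
    (fun i hi t ht => ht.ensures_drawVertex (hi.trans_le hk))
    (fun i hi t ht => ht.expectedValue_drawVertex_le (hi.trans_le hk) hφ)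
    (drawn_zero sampling hn htab)

end Drawing

/-! ### The requests -/

section Requests

open Finset

/-- The vertices that are not among the first `i` sampled ones. -/
def unsampled (n : ℕ) (p : ℕ → ℕ) (i : ℕ) : Finset ℕ := range n \ (range i).image p

variable {n i : ℕ} {p : ℕ → ℕ} {s t : Config Reg Tab}

theorem mem_unsampled {x : ℕ} : x ∈ unsampled n p i ↔ x < n ∧ ∀ j < i, p j ≠ x := by
  simp [unsampled]

theorem unsampled_zero (n : ℕ) (p : ℕ → ℕ) : unsampled n p 0 = range n := by
  simp [unsampled]

theorem unsampled_succ (n : ℕ) (p : ℕ → ℕ) (i : ℕ) :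
    unsampled n p (i + 1) = (unsampled n p i).erase (p i) := by
  rw [unsampled, range_add_one, image_insert, sdiff_insert]
  rfl

theorem le_card_unsampled_add (n : ℕ) (p : ℕ → ℕ) (i : ℕ) : n ≤ #(unsampled n p i) + i := by
  have := le_card_sdiff ((range i).image p) (range n)
  have : #((range i).image p) ≤ i := card_image_le.trans_eq (card_range i)
  rw [unsampled]
  simp only [card_range] at *
  omega

theorem two_mul_choose_two_add (k m : ℕ) :
    2 * (k + m).choose 2 = (2 * (k + m) - 1 - k) * k + 2 * m.choose 2 := by
  cases k with
  | zero => simp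
  | succ k =>
    have width : 2 * (k + 1 + m) - 1 - (k + 1) = k + 2 * m := by omega
    rw [width]
    qify
    rw [Nat.cast_choose_two, Nat.cast_choose_two]
    push_cast
    ring

/-- The configurations in which the requests for the first `i` vertices of the sample `p` have been
made. -/
structure Requested (n : ℕ) (p : ℕ → ℕ) (i : ℕ) (s : Config Reg Tab) : Prop where
  mark : ∀ x, s.tab .mark x 0 = 0 ↔ ∀ j < i, p j ≠ x
  length_add_le : s.requests.length + (#(unsampled n p i)).choose 2 ≤ n.choose 2
  mem : ∀ j < i, p j ∈ unsampled n p j → ∀ w ∈ unsampled n p (j + 1), (p j, w) ∈ s.requests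

/-- The part of the program that requests the pairs of one vertex with all unmarked vertices. -/
def requestPairs : Cmd Reg Tab :=
  .loop .w (var .n) <|
    .when (eq (get .mark (var .w) (const 0)) (const 0)) <|
      .ask (var .v) (var .w)

/-- The part of the program that requests the pairs with one vertex of the sample. -/
def requestNeighbourhood : Cmd Reg Tab :=
  .seq (.set .v (get .sample (var .i) (const 0))) <|
  .when (eq (get .mark (var .v) (const 0)) (const 0)) <|
    .seq (.put .mark (var .v) (const 0) (const 1)) requestPairs

/-- The unmarked vertices among `0, …, m - 1`. -/
def unmarked (s : Config Reg Tab) (m : ℕ) : List ℕ :=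
  (List.range m).filter fun w => s.tab .mark w 0 = 0

theorem ensures_requestPairs (s : Config Reg Tab) :
    requestPairs.Ensures s fun t => t.tab = s.tab ∧
      t.requests = ((unmarked s (s.reg .n)).map (s.reg .v, ·)).reverse ++ s.requests := by
  have fixed : requestPairs.Fixes fun t : Config Reg Tab => (t.reg .v, t.tab) := by
    simp [requestPairs, Fixes, funext_iff]
  refine .and ((fixed.ensures (fun _ _ => rfl) s).mono fun t ht => congrArg Prod.snd ht) <|
    fixed.ensures_loop (fun _ _ => rfl)
    (fun m t => t.requests = ((unmarked s m).map (s.reg .v, ·)).reverse ++ s.requests) rfl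
    fun w _ t ht hreq => ?_
  simp only [Prod.mk.injEq] at ht
  refine ensures_when.2 ⟨fun hw => ensures_ask.2 ?_, fun hw => ?_⟩ <;>
  · simp only [eval, Config.setReg_reg, Config.tick_reg, Config.setReg_tab, Config.tick_tab, ht,
      Function.update_self, ne_eq, ite_eq_right_iff, one_ne_zero, imp_false, not_not] at hw
    simp [unmarked, List.range_succ, hw, hreq, eval, ht]

theorem mem_unmarked (hmark : ∀ x, s.tab .mark x 0 = 0 ↔ ∀ j < i, p j ≠ x) {w : ℕ} :
    w ∈ unmarked s n ↔ w ∈ unsampled n p i := by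
  simp [unmarked, mem_unsampled, hmark]

theorem length_unmarked (hmark : ∀ x, s.tab .mark x 0 = 0 ↔ ∀ j < i, p j ≠ x) :
    (unmarked s n).length = #(unsampled n p i) := by
  have nodup : (unmarked s n).Nodup := List.nodup_range.filter _
  rw [← List.toFinset_card_of_nodup nodup]
  congr 1
  ext w
  rw [List.mem_toFinset, mem_unmarked hmark]

namespace Requested

theorem of_zero (hmark : ∀ x, s.tab .mark x 0 = 0) (hreq : s.requests = []) :
    Requested n p 0 s where
  mark x := by simp [hmark]
  length_add_le := by simp [hreq, unsampled_zero]
  mem j hj := absurd hj j.not_lt_zero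

theorem succ_of_mark_ne_zero (hs : Requested n p i s) (h : s.tab .mark (p i) 0 ≠ 0) :
    Requested n p (i + 1) s := by
  have sampled : ∃ j < i, p j = p i := by simpa [hs.mark] using h
  have notMem : p i ∉ unsampled n p i := fun hmem => by
    obtain ⟨j, hj, hji⟩ := sampled
    exact (mem_unsampled.1 hmem).2 j hj hji
  refine ⟨fun x => ?_, ?_, fun j hj hpj => ?_⟩
  · rw [hs.mark, Nat.forall_lt_succ_right]
    exact ⟨fun hx => ⟨hx, by grind⟩, And.left⟩
  · rw [unsampled_succ, erase_eq_of_notMem notMem]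
    exact hs.length_add_le
  · rcases Nat.lt_succ_iff_lt_or_eq.1 hj with hj | rfl
    exacts [hs.mem j hj hpj, absurd hpj notMem]

theorem succ_of_mark_eq_zero (hs : Requested n p i s) (hlt : p i < n)
    (h : s.tab .mark (p i) 0 = 0)
    (hmark : ∀ x, t.tab .mark x 0 = if x = p i then 1 else s.tab .mark x 0)
    (hreq : t.requests = ((unmarked t n).map (p i, ·)).reverse ++ s.requests) :
    Requested n p (i + 1) t := by
  have mark : ∀ x, t.tab .mark x 0 = 0 ↔ ∀ j < i + 1, p j ≠ x := fun x => by
    rw [hmark, Nat.forall_lt_succ_right, ← hs.mark, ite_eq_iff, ne_comm]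
    simp [and_comm]
  refine ⟨mark, ?_, fun j hj hpj w hw => ?_⟩
  · have card_succ : #(unsampled n p (i + 1)) + 1 = #(unsampled n p i) := by
      rw [unsampled_succ]
      exact card_erase_add_one (mem_unsampled.2 ⟨hlt, (hs.mark _).1 h⟩)
    have bound := hs.length_add_le
    have pascal (m : ℕ) : (m + 1).choose 2 = m + m.choose 2 := by
      rw [Nat.choose_succ_succ', Nat.choose_one_right]
    rw [← card_succ, pascal] at bound
    simp only [hreq, List.length_append, List.length_reverse, List.length_map,
      length_unmarked mark]
    omega
  · rw [hreq, List.mem_append, List.mem_reverse, List.mem_map]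
    rcases Nat.lt_succ_iff_lt_or_eq.1 hj with hj | rfl
    exacts [.inr (hs.mem j hj hpj w hw), .inl ⟨w, (mem_unmarked mark).2 hw, rfl⟩]

theorem length_le {Q : ℕ} (hs : Requested n p (sampleSize n Q) s) : s.requests.length ≤ Q := by
  obtain ⟨m, hm⟩ := Nat.exists_eq_add_of_le (sampleSize_le n Q)
  have spec := sampleSize_spec n Q
  have choose_le : m.choose 2 ≤ (#(unsampled n p (sampleSize n Q))).choose 2 :=
    Nat.choose_mono 2 (by have := le_card_unsampled_add n p (sampleSize n Q); omega)
  have length_le := (Nat.add_le_add_left choose_le _).trans hs.length_add_le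
  have choose_n := two_mul_choose_two_add (sampleSize n Q) m
  rw [← hm] at choose_n
  omega

end Requested

theorem ensures_requestNeighbourhood (hs : Requested n (samples s) i s) (hn : s.reg .n = n)
    (hlt : samples s i < n) :
    requestNeighbourhood.Ensures ((s.setReg .i i).tick 1) (Requested n (samples s) (i + 1)) := by
  have v_eq : (get .sample (var .i) (const 0)).eval ((s.setReg .i i).tick 1) = samples s i := by
    simp [eval, samples]
  refine ensures_seq.2 (ensures_set.2 ?_)
  rw [v_eq]
  refine ensures_when.2 ⟨fun h => ?_, fun h => ?_⟩ <;>
    simp only [eval, Config.setReg_tab, Config.setReg_reg, Config.tick_tab, Config.tick_reg,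
      Function.update_self, ne_eq, ite_eq_right_iff, one_ne_zero, imp_false, not_not] at h
  · refine ensures_seq.2 <| ensures_put.2 <| (ensures_requestPairs _).mono
      fun t ⟨tab_eq, requests_eq⟩ => ?_
    refine hs.succ_of_mark_eq_zero hlt h (fun x => ?_) ?_
    · rcases eq_or_ne x (samples s i) with rfl | hx
      · simp [tab_eq, eval]
      · simp [tab_eq, eval, hx]
    · simp [tab_eq, requests_eq, unmarked, eval, hn]
  · have succ := hs.succ_of_mark_ne_zero h
    exact ⟨succ.mark, succ.length_add_le, succ.mem⟩

theorem ensures_requestNeighbourhoods (hmark : ∀ x, s.tab .mark x 0 = 0) (hreq : s.requests = [])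
    (hn : s.reg .n = n) (hlt : ∀ j < s.reg .k, samples s j < n) :
    requestNeighbourhoods.Ensures s (Requested n (samples s) (s.reg .k)) := by
  have fixed : requestNeighbourhoods.Fixes fun t : Config Reg Tab => (t.reg .n, samples t) := by
    simp [requestNeighbourhoods, Fixes, samples, funext_iff]
  refine fixed.ensures_loop (fun _ _ => rfl) (Requested n (samples s)) (.of_zero hmark hreq)
    fun i hi t ht hreq => ?_
  obtain ⟨n_eq, samples_eq⟩ := Prod.mk.inj ht
  rw [← samples_eq] at hreq hlt ⊢
  exact ensures_requestNeighbourhood hreq (n_eq.trans hn) (hlt i hi)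

end Requests

/-! ### The clusters -/

section Clusters

variable {n i : ℕ} {G : SimpleGraph (Fin n)} {s : Config Reg Tab}

/-- The labels stored in a configuration. -/
def labels (n : ℕ) (s : Config Reg Tab) (w : Fin n) : ℕ := s.tab .label w 0

/-- The condition that a vertex belongs to the cluster of the current pivot, as an expression of the
program. -/
def joinsCluster : Expr Reg Tab :=
  and (eq (get .label (var .w) (const 0)) (const 0))
    (or (eq (var .w) (var .v)) (answer (var .v) (var .w)))

/-- The part of the program that labels the cluster of one pivot. -/
def formCluster : Cmd Reg Tab :=
  .loop .w (var .n) <|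
    .when joinsCluster <|
      .put .label (var .w) (const 0) (add (var .i) (const 1))

/-- The part of the program that considers one vertex of the sample as a pivot. -/
def considerPivot : Cmd Reg Tab :=
  .seq (.set .v (get .sample (var .i) (const 0))) <|
  .when (eq (get .label (var .v) (const 0)) (const 0)) formCluster

theorem eval_joinsCluster_ne_zero {v w : Fin n} (hv : s.reg .v = v) (hw : s.reg .w = w) :
    joinsCluster.eval s ≠ 0 ↔ labels n s w = 0 ∧ (w = v ∨ s.answers v w ≠ 0) := by
  simp [joinsCluster, eval, hv, hw, labels, Fin.ext_iff, or_iff_not_imp_left]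

theorem ensures_formCluster {v : Fin n} (hn : s.reg .n = n) (hv : s.reg .v = v)
    (hl : labels n s v = 0)
    (hans : ∀ w, w ≠ v → labels n s w = 0 → (s.answers v w ≠ 0 ↔ G.Adj v w)) :
    formCluster.Ensures s fun t =>
      labels n t = pivotStep G (s.reg .i + 1) (labels n s) v := by
  set l' := pivotStep G (s.reg .i + 1) (labels n s) v with hl'
  have fixed : formCluster.Fixes fun t : Config Reg Tab => (t.reg .i, t.reg .v, t.answers) := by
    simp [formCluster, Fixes, funext_iff]
  refine (fixed.ensures_loop (fun _ _ => rfl)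
    (fun m t => ∀ w : Fin n, labels n t w = if w < m then l' w else labels n s w)
    (fun w => rfl) fun m hm t ht hlab => ?_).mono fun t ht => funext fun w => ?_
  · obtain ⟨m, rfl⟩ : ∃ w : Fin n, m = w := ⟨⟨m, by simpa [eval, hn] using hm⟩, rfl⟩
    simp only [Prod.mk.injEq, hv] at ht
    have label_m : labels n t m = labels n s m := (hlab m).trans (if_neg (lt_irrefl _))
    have next {u : Config Reg Tab} (hm : labels n u m = l' m)
        (hu : ∀ w ≠ m, labels n u w = labels n t w) (w : Fin n) :
        labels n u w = if (w : ℕ) < m + 1 then l' w else labels n s w := by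
      grind
    have joins : joinsCluster.eval ((t.setReg .w m).tick 1) ≠ 0 ↔
        labels n s m = 0 ∧ (m = v ∨ G.Adj v m) := by
      have answer_m := hans m
      rw [eval_joinsCluster_ne_zero (v := v) (w := m) (by simp [ht]) (by simp),
        show labels n ((t.setReg .w m).tick 1) m = labels n s m from label_m,
        Config.tick_answers, Config.setReg_answers, ht.2.2]
      tauto
    refine ensures_when.2 ⟨fun h => ensures_put.2 (next ?_ fun w hw => ?_), fun h => next ?_ ?_⟩
    · have newLabel : l' m = s.reg .i + 1 := if_pos ⟨hl, joins.1 h⟩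
      simp [labels, eval, ht, newLabel]
    · simp [labels, eval, Fin.val_ne_of_ne hw]
    · have h := joins.not.1 (not_not.2 h)
      rw [hl', pivotStep, if_neg fun h' => h h'.2]
      exact label_m
    · exact fun w _ => rfl
  · rw [ht w, if_pos]
    simp [eval, hn]

theorem ensures_considerPivot (hn : s.reg .n = n) {v : Fin n} (hv : samples s i = v)
    (hans : labels n s v = 0 → ∀ w, w ≠ v → labels n s w = 0 → (s.answers v w ≠ 0 ↔ G.Adj v w)) :
    considerPivot.Ensures ((s.setReg .i i).tick 1) fun t =>
      labels n t = pivotStep G (i + 1) (labels n s) v := by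
  have v_eq : (get .sample (var .i) (const 0)).eval ((s.setReg .i i).tick 1) = v := by
    simp [eval, ← hv, samples]
  refine ensures_seq.2 (ensures_set.2 ?_)
  rw [v_eq]
  have unlabelled_iff (m : ℕ) :
      (eq (get .label (var .v) (const 0)) (const 0)).eval
        ((((s.setReg .i i).tick 1).setReg .v v).tick m) ≠ 0 ↔ labels n s v = 0 := by
    simp [eval, labels]
  refine ensures_when.2 ⟨fun h => ?_, fun h => ?_⟩
  · have h := (unlabelled_iff _).1 h
    exact ensures_formCluster hn rfl h (hans h)
  · have h := (unlabelled_iff _).not.1 (not_not.2 h)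
    exact (pivotStep_eq_self G _ h).symm

theorem ensures_clusterPhase (hn : s.reg .n = n) (hlab : labels n s = fun _ => 0)
    (hlt : ∀ j < s.reg .k, samples s j < n)
    (hans : ∀ j < s.reg .k, ∀ v w : Fin n, samples s j = v → w ≠ v →
      pivotLabels G (samples s) j v = 0 → pivotLabels G (samples s) j w = 0 →
      (s.answers v w ≠ 0 ↔ G.Adj v w)) :
    clusterPhase.Ensures s fun t => labels n t = pivotLabels G (samples s) (s.reg .k) := by
  have fixed : clusterPhase.Fixes fun t : Config Reg Tab => (t.reg .n, samples t, t.answers) := by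
    simp [clusterPhase, Fixes, samples, funext_iff]
  refine fixed.ensures_loop (fun _ _ => rfl)
    (fun i t => labels n t = pivotLabels G (samples s) i) hlab fun i hi t ht hlab => ?_
  simp only [Prod.mk.injEq] at ht
  obtain ⟨v, hv⟩ : ∃ v : Fin n, samples s i = v := ⟨⟨_, hlt i hi⟩, rfl⟩
  rw [pivotLabels_succ hv, ← hlab]
  refine ensures_considerPivot (ht.1.trans hn) (ht.2.1 ▸ hv) fun hv0 w hw hw0 => ?_
  rw [hlab] at hv0 hw0
  rw [ht.2.2]
  exact hans i hi v w hv hw hv0 hw0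

end Clusters

/-! ### The whole algorithm -/

section Run

variable {sampling : Sampling} {n Q : ℕ} {G : SimpleGraph (Fin n)} {s : Config Reg Tab}

/-- The configurations reached by the querying phase with budget `Q`. -/
structure Queried (sampling : Sampling) (n Q : ℕ) (s : Config Reg Tab) : Prop
    extends Drawn sampling n (sampleSize n Q) s where
  reg_k : s.reg .k = sampleSize n Q
  labels : labels n s = fun _ => 0
  requested : Requested n (samples s) (sampleSize n Q) s

theorem Drawn.congr {i : ℕ} {t : Config Reg Tab} (hs : Drawn sampling n i s)
    (hn : t.reg .n = s.reg .n) (hsamples : samples t = samples s) (hentry : entry t = entry s) :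
    Drawn sampling n i t where
  reg_n := hn.trans hs.reg_n
  samples_lt := hsamples ▸ hs.samples_lt
  shuffled h := hsamples ▸ hentry ▸ hs.shuffled h

theorem computeK_fixes : computeK.Fixes fun s => (s.reg .n, s.tab, s.requests) := by
  simp [computeK, Fixes, funext_iff]

theorem drawSample_fixes (sampling : Sampling) :
    (drawSample sampling).Fixes fun s =>
      (s.reg .n, s.reg .k, s.tab .mark, s.tab .label, s.requests) := by
  cases sampling <;> simp [drawSample, Fixes, funext_iff]

theorem requestNeighbourhoods_fixes :
    requestNeighbourhoods.Fixes fun s =>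
      (s.reg .n, s.reg .k, s.tab .sample, s.tab .swap, s.tab .label) := by
  simp [requestNeighbourhoods, Fixes, funext_iff]

theorem clusterPhase_fixes_requests : clusterPhase.Fixes fun s => s.requests := by
  simp [clusterPhase, Fixes]

theorem ensures_computeK_init (n Q : ℕ) :
    computeK.Ensures (init n Q) fun s => s.reg .n = n ∧ s.reg .k = sampleSize n Q ∧
      (s.tab = fun _ _ _ => 0) ∧ s.requests = [] := by
  refine ((ensures_computeK (init n Q)).and
    (computeK_fixes.ensures (fun _ _ => rfl) (init n Q))).mono fun s ⟨k_eq, hs⟩ => ?_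
  simp only [Prod.mk.injEq] at hs
  exact ⟨hs.1, k_eq, hs.2⟩

theorem Drawn.ensures_requestNeighbourhoods (hs : Drawn sampling n (sampleSize n Q) s)
    (hk : s.reg .k = sampleSize n Q) (htab : s.tab .mark = fun _ _ => 0)
    (hlab : NAQECC.labels n s = fun _ => 0) (hreq : s.requests = []) :
    requestNeighbourhoods.Ensures s (Queried sampling n Q) := by
  have hlt : ∀ j < s.reg .k, samples s j < n := hk ▸ hs.samples_lt
  refine ((NAQECC.ensures_requestNeighbourhoods (fun x => by rw [htab]) hreq hs.reg_n hlt).and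
    (requestNeighbourhoods_fixes.ensures (fun _ _ => rfl) s)).mono fun t ⟨hreq, ht⟩ => ?_
  simp only [Prod.mk.injEq] at ht
  obtain ⟨n_eq, k_eq, sample_eq, swap_eq, label_eq⟩ := ht
  have samples_eq : samples t = samples s := funext fun j => by rw [samples, sample_eq, samples]
  have entry_eq : entry t = entry s := funext fun j => by rw [entry, swap_eq, entry]
  refine ⟨hs.congr n_eq samples_eq entry_eq, k_eq.trans hk, ?_, ?_⟩
  · rw [← hlab]
    exact funext fun w => by rw [labels, label_eq, labels]
  · rwa [samples_eq, ← hk]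

theorem ensures_queryPhase (sampling : Sampling) (n Q : ℕ) :
    (queryPhase sampling).Ensures (init n Q) (Queried sampling n Q) := by
  refine ensures_seq.2 ((ensures_computeK_init n Q).mono fun s ⟨hn, hk, htab, hreq⟩ => ?_)
  have k_le : s.reg .k ≤ n := hk.trans_le (sampleSize_le n Q)
  refine ensures_seq.2 (((ensures_drawSample sampling hn k_le htab).and
    ((drawSample_fixes sampling).ensures (fun _ _ => rfl) s)).mono fun t ⟨drawn, ht⟩ => ?_)
  simp only [Prod.mk.injEq, htab, hk, hreq] at ht
  obtain ⟨-, k_eq, mark_eq, label_eq, requests_eq⟩ := ht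
  exact (hk ▸ drawn).ensures_requestNeighbourhoods k_eq mark_eq
    (funext fun w => by rw [labels, label_eq]) requests_eq

theorem Queried.ensures_clusterPhase (hs : Queried sampling n Q s) :
    clusterPhase.Ensures (s.answerRequests G) fun t =>
      NAQECC.labels n t = pivotLabels G (samples s) (sampleSize n Q) := by
  rw [← hs.reg_k]
  refine NAQECC.ensures_clusterPhase hs.reg_n hs.labels ?_ fun j hj v w hv hw hv0 hw0 => ?_
  · exact hs.reg_k ▸ hs.samples_lt
  replace hv : samples s j = v := hv
  have fresh {x : Fin n} (hx : pivotLabels G (samples s) j x = 0) : ∀ i < j, samples s i ≠ x :=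
    fun i hi h => pivotLabels_ne_zero hi h hx
  have requested : ((v : ℕ), (w : ℕ)) ∈ s.requests := by
    rw [← hv]
    refine hs.requested.mem j (hs.reg_k ▸ hj) ?_ w ?_
    · exact hv ▸ mem_unsampled.2 ⟨v.is_lt, fresh hv0⟩
    · rw [unsampled_succ, Finset.mem_erase, hv]
      exact ⟨Fin.val_ne_of_ne hw, mem_unsampled.2 ⟨w.is_lt, fresh hw0⟩⟩
  simp [requested]

theorem mem_support_run {t : Config Reg Tab} :
    t ∈ (run sampling G Q).support ↔ ∃ s ∈ ((queryPhase sampling).run (init n Q)).support,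
      t ∈ (clusterPhase.run (s.answerRequests G)).support :=
  PMF.mem_support_bind_iff _ _ _

theorem length_requests_le : ∀ t ∈ (run sampling G Q).support, t.requests.length ≤ Q := by
  intro t ht
  obtain ⟨s, hs, ht⟩ := mem_support_run.1 ht
  have requests_eq : t.requests = s.requests :=
    clusterPhase_fixes_requests.ensures (fun _ _ => rfl) (s.answerRequests G) t ht
  exact requests_eq ▸ (ensures_queryPhase sampling n Q s hs).requested.length_le

theorem map_requests_run (sampling : Sampling) (G : SimpleGraph (Fin n)) (Q : ℕ) :
    (run sampling G Q).map (fun s => s.requests) =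
      ((queryPhase sampling).run (init n Q)).map fun s => s.requests := by
  rw [run, PMF.map_bind, ← PMF.bind_pure_comp]
  congr 1
  funext s
  exact clusterPhase_fixes_requests.map_run (fun _ _ => rfl) (s.answerRequests G)

/-! ### The running time -/

theorem ensures_time_computeK (s : Config Reg Tab) :
    computeK.Ensures s fun t => t.time ≤ s.time + (4 + (s.reg .Q + 2) * 21) := by
  refine ensures_time_le ?_ s
  simp [computeK, ranges, Fixes, eval]

theorem ensures_time_drawSample_requestNeighbourhoods (sampling : Sampling)
    (s : Config Reg Tab) :
    (seq (drawSample sampling) requestNeighbourhoods).Ensures s fun t =>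
      t.time ≤ s.time + (4 + s.reg .k * 60 + s.reg .k * s.reg .n * 10) := by
  refine (ensures_time_le ?_ s).mono fun t ht => ht.trans (Nat.add_le_add_left ?_ _)
  · cases sampling <;> simp [drawSample, requestNeighbourhoods, ranges, Fixes, eval]
  · cases sampling <;> simp only [drawSample, requestNeighbourhoods, maxTime, steps, eval] <;>
      linarith

theorem ensures_time_clusterPhase (s : Config Reg Tab) :
    clusterPhase.Ensures s fun t =>
      t.time ≤ s.time + (2 + s.reg .k * 13 + s.reg .k * s.reg .n * 21) := by
  refine (ensures_time_le ?_ s).mono fun t ht => ht.trans_eq (congrArg (s.time + ·) ?_)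
  · simp [clusterPhase, ranges, Fixes, eval]
  · simp only [clusterPhase, maxTime, steps, eval]
    ring

theorem ensures_time_queryPhase (sampling : Sampling) (n Q : ℕ) :
    (queryPhase sampling).Ensures (init n Q) fun t =>
      t.time ≤ 50 + Q * 21 + sampleSize n Q * 60 + sampleSize n Q * n * 10 := by
  refine ensures_seq.2 (((ensures_time_computeK (init n Q)).and (ensures_computeK_init n Q)).mono
    fun s ⟨time_le, hn, hk, _⟩ => ?_)
  refine (ensures_time_drawSample_requestNeighbourhoods sampling s).mono fun t ht => ?_
  rw [hn, hk] at ht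
  simp only [init] at time_le
  omega

theorem time_le (hQ : 0 < Q) : ∀ t ∈ (run sampling G Q).support, t.time ≤ 344 * Q := by
  intro t ht
  obtain ⟨s, hs, ht⟩ := mem_support_run.1 ht
  have queried := ensures_queryPhase sampling n Q s hs
  have query_time := ensures_time_queryPhase sampling n Q s hs
  have cluster_time : t.time ≤ s.time + s.requests.length +
      (2 + s.reg .k * 13 + s.reg .k * s.reg .n * 21) :=
    ensures_time_clusterPhase (s.answerRequests G) t ht
  rw [queried.reg_k, queried.reg_n] at cluster_time
  have := queried.requested.length_le
  have := sampleSize_le_succ n Q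
  have := sampleSize_mul_le n Q
  omega

end Run

/-! ### The expected cost -/

section Cost

open Finset

variable {sampling : Sampling} {n Q : ℕ} {G : SimpleGraph (Fin n)} {s : Config Reg Tab}

theorem output_eq_iff {x y : Fin n} (hxy : x ≠ y) :
    output n s x = output n s y ↔ labels n s x = labels n s y ∧ labels n s x ≠ 0 := by
  have := Fin.val_ne_of_ne hxy
  simp only [output, labels]
  split_ifs <;> omega

theorem two_mul_clusteringCost_output (G : SimpleGraph (Fin n)) (s : Config Reg Tab) :
    2 * clusteringCost G (output n s) =
      #(closedPairs G (labels n s)) + #(pairsIn G.Adj (unlabelled (labels n s))) :=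
  (two_mul_clusteringCost G _).trans
    (card_pairsIn_disagreement_eq G fun _ _ hxy => output_eq_iff hxy)

theorem expectedValue_queryPhase_le {φ : ℕ → (Fin n → ℕ) → ℕ} (hφ : PivotPotential G φ)
    (sampling : Sampling) (Q : ℕ) :
    expectedValue ((queryPhase sampling).run (init n Q)) (fun s =>
        (φ (sampleSize n Q) (pivotLabels G (samples s) (sampleSize n Q)) : ℝ≥0∞)) ≤
      φ 0 (fun _ => 0) := by
  rw [queryPhase, Cmd.run, expectedValue_bind]
  refine expectedValue_le_of_support fun s hs => ?_
  obtain ⟨hn, hk, htab, -⟩ := ensures_computeK_init n Q s hs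
  rw [Cmd.run, expectedValue_bind]
  refine le_trans (expectedValue_mono fun t _ => expectedValue_le_of_support fun u hu => ?_)
    (expectedValue_drawSample_le sampling hφ hn (hk.trans_le (sampleSize_le n Q)) htab)
  have same_samples : samples u = samples t :=
    Fixes.ensures (by simp [requestNeighbourhoods, Fixes, samples, funext_iff])
      (fun _ _ => rfl) t u hu
  rw [same_samples, hk]

theorem succ_mul_card_pairsIn_le_edgePotential (G : SimpleGraph (Fin n)) (i : ℕ)
    (l : Fin n → ℕ) :
    (i + 1) * #(pairsIn G.Adj (unlabelled l)) ≤ edgePotential G i l := by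
  have card_le : #(unlabelled l) ≤ Fintype.card (Fin n) := card_le_univ _
  have pairs_le := (card_pairsIn_le G.Adj (unlabelled l)).trans (Nat.mul_le_mul_right _ card_le)
  rw [add_one_mul, edgePotential]
  omega

theorem Queried.unlabelled_eq_empty (hs : Queried .withoutReplacement n Q s)
    (hK : sampleSize n Q = n) :
    unlabelled (pivotLabels G (samples s) (sampleSize n Q)) = ∅ := by
  refine eq_empty_of_forall_notMem fun w hw => ?_
  have fresh {j : ℕ} (hj : j < sampleSize n Q) : samples s j ≠ w := fun h =>
    pivotLabels_ne_zero hj h (mem_unlabelled.1 hw)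
  obtain ⟨j, hj, hjn, -⟩ := (hs.shuffled rfl).cover w w.is_lt fun _ => fresh
  exact hjn.not_ge (hK ▸ hj)

theorem Queried.mul_card_pairsIn_le (hs : Queried sampling n Q s)
    (hQ : sampling = .withoutReplacement ∨ Q ≤ n ^ 2) :
    Q * #(pairsIn G.Adj (unlabelled (pivotLabels G (samples s) (sampleSize n Q)))) ≤
      n * edgePotential G (sampleSize n Q) (pivotLabels G (samples s) (sampleSize n Q)) := by
  have potential := succ_mul_card_pairsIn_le_edgePotential G (sampleSize n Q)
    (pivotLabels G (samples s) (sampleSize n Q))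
  by_cases hQn : Q ≤ (sampleSize n Q + 1) * n
  · calc _ ≤ (sampleSize n Q + 1) * n * #(pairsIn G.Adj (unlabelled _)) :=
          Nat.mul_le_mul_right _ hQn
      _ = n * ((sampleSize n Q + 1) * #(pairsIn G.Adj (unlabelled _))) := by ring
      _ ≤ _ := Nat.mul_le_mul_left n potential
  have hK : sampleSize n Q = n :=
    (sampleSize_le n Q).eq_of_not_lt fun h => hQn (le_succ_sampleSize_mul h)
  rw [hK] at hQn
  obtain rfl : sampling = .withoutReplacement :=
    hQ.resolve_right fun h => hQn (by nlinarith)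
  rw [hs.unlabelled_eq_empty hK]
  simp [pairsIn, Rel.interedges]

theorem mul_two_mul_clusteringCost_le (hQ : sampling = .withoutReplacement ∨ Q ≤ n ^ 2)
    (hs : Queried sampling n Q s) (o : Fin n → ℕ) :
    clusterPhase.Ensures (s.answerRequests G) fun t =>
      Q * (2 * clusteringCost G (output n t)) ≤
        Q * costPotential G o (pivotLabels G (samples s) (sampleSize n Q)) +
          n * edgePotential G (sampleSize n Q) (pivotLabels G (samples s) (sampleSize n Q)) := by
  refine hs.ensures_clusterPhase.mono fun t ht => ?_
  rw [two_mul_clusteringCost_output, ht, mul_add]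
  exact Nat.add_le_add (Nat.mul_le_mul_left Q (Nat.le_add_right _ _)) (hs.mul_card_pairsIn_le hQ)

theorem mul_expectedValue_cost_le (hQ : sampling = .withoutReplacement ∨ Q ≤ n ^ 2) :
    Q * (2 * expectedValue (run sampling G Q) fun s => (clusteringCost G (output n s) : ℝ≥0∞)) ≤
      Q * (2 * (3 * (optCost G : ℝ≥0∞))) + n ^ 3 := by
  obtain ⟨o, ho⟩ := exists_clusteringCost_eq_optCost (G := G)
  set K := sampleSize n Q
  set l := fun s : Config Reg Tab => pivotLabels G (samples s) K
  set q := (queryPhase sampling).run (init n Q)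
  have cost_charge : expectedValue q (fun s => (costPotential G o (l s) : ℝ≥0∞)) ≤
      (2 * (3 * optCost G) : ℕ) := by
    rw [← ho, ← costPotential_zero]
    exact expectedValue_queryPhase_le (pivotPotential_costPotential G o) sampling Q
  have edge_bound : expectedValue q (fun s => (edgePotential G K (l s) : ℝ≥0∞)) ≤
      (n ^ 2 : ℕ) := by
    rw [← edgePotential_zero (G := G)]
    exact expectedValue_queryPhase_le (pivotPotential_edgePotential G) sampling Q
  calc Q * (2 * expectedValue (run sampling G Q) fun s => (clusteringCost G (output n s) : ℝ≥0∞))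
    _ = expectedValue q fun s => expectedValue (clusterPhase.run (s.answerRequests G))
          fun t => (Q * (2 * clusteringCost G (output n t)) : ℝ≥0∞) := by
      simp only [expectedValue_const_mul, run, expectedValue_bind, q]
    _ ≤ expectedValue q fun s =>
          (Q * costPotential G o (l s) + n * edgePotential G K (l s) : ℝ≥0∞) :=
      expectedValue_mono fun s hs => expectedValue_le_of_support fun t ht =>
        mod_cast mul_two_mul_clusteringCost_le hQ (ensures_queryPhase sampling n Q s hs) o t ht
    _ ≤ Q * (2 * (3 * optCost G) : ℕ) + n * (n ^ 2 : ℕ) := by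
      rw [expectedValue_add, expectedValue_const_mul, expectedValue_const_mul]
      gcongr
    _ = Q * (2 * (3 * (optCost G : ℝ≥0∞))) + n ^ 3 := by
      push_cast
      ring

theorem expectedValue_cost_le (h0 : 0 < Q) (hQ : sampling = .withoutReplacement ∨ Q ≤ n ^ 2) :
    expectedValue (run sampling G Q) (fun s => (clusteringCost G (output n s) : ℝ≥0∞)) ≤
      3 * (optCost G : ℝ≥0∞) + (n : ℝ≥0∞) ^ 3 / (2 * (Q : ℝ≥0∞)) := by
  have two_mul_ne_zero : (2 * Q : ℝ≥0∞) ≠ 0 := by simpa using h0.ne'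
  have two_mul_ne_top : (2 * Q : ℝ≥0∞) ≠ ∞ := mod_cast ENNReal.natCast_ne_top (2 * Q)
  rw [← ENNReal.mul_le_mul_iff_right two_mul_ne_zero two_mul_ne_top, mul_add,
    ENNReal.mul_div_cancel two_mul_ne_zero two_mul_ne_top]
  convert mul_expectedValue_cost_le (sampling := sampling) (G := G) hQ using 1 <;> ring

end Cost

end NAQECC

theorem theorem2 :
    ∃ c : ℕ, ∀ (sampling : NAQECC.Sampling) (n Q : ℕ) (G : SimpleGraph (Fin n)), 0 < Q →
      -- expected cost (a sample drawn with replacement need not contain all the vertices, so for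
      -- it the budget is taken within the quadratic range)
      ((sampling = .withoutReplacement ∨ Q ≤ n ^ 2) →
        expectedValue (NAQECC.run sampling G Q)
            (fun s => (clusteringCost G (NAQECC.output n s) : ℝ≥0∞)) ≤
          3 * (optCost G : ℝ≥0∞) + (n : ℝ≥0∞) ^ 3 / (2 * (Q : ℝ≥0∞))) ∧
      -- number of queries, and running time
      (∀ s ∈ (NAQECC.run sampling G Q).support, s.requests.length ≤ Q ∧ s.time ≤ c * Q) ∧
      -- the queries do not depend on the answers
      (∀ H : SimpleGraph (Fin n),
        (NAQECC.run sampling G Q).map (fun s => s.requests) =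
          (NAQECC.run sampling H Q).map (fun s => s.requests)) := by
  refine ⟨344, fun sampling n Q G hQ => ⟨?_, fun s hs => ⟨?_, ?_⟩, fun H => ?_⟩⟩
  · exact NAQECC.expectedValue_cost_le hQ
  · exact NAQECC.length_requests_le s hs
  · exact NAQECC.time_le hQ s hs
  · rw [NAQECC.map_requests_run, NAQECC.map_requests_run]
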